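/- Let $F$ be the free inverse monoid on $\{a\}$, that is, the quotient of $\{a,a^{-1}\}^*$ by the Wagner congruence, generated by the pairs $(ww^{-1}w,\,w)$ and $(uu^{-1}vv^{-1},\,vv^{-1}uu^{-1})$ for words $u,v,w$; let $\theta:\{a,a^{-1}\}^*\to F$ be the canonical homomorphism. Every $u\in F$ factors uniquely as $u=a^{-m}a^{m+k}a^{-k}a^{p}$ with $m,k\in\mathbb N$ and $-m\le p\le k$; write $u\lambda=-m$, $u\rho=k$, $u\pi=p$ (maps are written on the right). Put $F^+=\{u\in F: u\pi\ge 0\}$ and, for $L\subseteq F$, $L^+=\{u\in L: u\pi\ge 0\}$, $L^-=\{u\in L: u\pi\le 0\}$, $L^{-1}=\{u^{-1}:u\in L\}$. For integers $n'\ge n\ge 1$ define $\eta_{n,n'}:\mathbb Z\to\mathbb Z$ by $m\eta_{n,n'}=m$ if $0\le m<n'$, $m\eta_{n,n'}=\max\{i\in\{0,1,\dots,n'-1\}: i\equiv m \pmod n\}$ if $m\ge n'$, and $(-m)\eta_{n,n'}=-(m\eta_{n,n'})$ for $m\ge 0$. Let $$W_{n'}=\{u\in F:\ u\lambda>-n',\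 0\le u\pi<n',\ u\rho-u\pi<n'\},$$ and let $\zeta_{n,n'}:F^+\to W_{n'}$ be the map determined by $$u\zeta_{n,n'}\lambda=(u\lambda)\eta_{n,n'},\quad u\zeta_{n,n'}\pi=(u\pi)\eta_{n,n'},\quad u\zeta_{n,n'}\rho-u\zeta_{n,n'}\pi=(u\rho-u\pi)\eta_{n,n'}.$$ For $X\subseteq F$ let $X\zeta_{n,n'}^{-1}=\{u\in F^+: u\zeta_{n,n'}\in X\}$. Let $\mathrm{Rat}(F)$ be the set of rational subsets of $F$, those obtained from finite subsets by finitely many unions, products and stars $X^*=\bigcup_{k\ge0}X^k$. **Theorem.** Every $L\in\mathrm{Rat}(F)$ is of the form $L=(L(\mathcal A))\theta$ for some finite automaton $\mathcal A$ over $\{a,a^{-1}\}$. Moreover, there are computable functions assigning to each finite automaton $\mathcal A$ over $\{a,a^{-1}\}$ integers $n,n'$ and two finite lists of words over $\{a,a^{-1}\}$, representing (through $\theta$) finite sets $W,W'\subseteq F$, such that for every $L\in\mathrm{Rat}(F)$ and every $\mathcal A$ with $L=(L(\mathcal A))\theta$ we have $n'\ge n\ge 1$ and: 1. $L^+=L^+\zeta_{n,n'}\zeta_{n,n'}^{-1}=(L\cap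 W_{n'})\zeta_{n,n'}^{-1}$; 2. $L^-=\big((L^-)^{-1}\zeta_{n,n'}\zeta_{n,n'}^{-1}\big)^{-1}=\big((L^{-1}\cap W_{n'})\zeta_{n,n'}^{-1}\big)^{-1}$; 3. $W,W'\subseteq W_{n'}$ and $L=W\zeta_{n,n'}^{-1}\cup(W'\zeta_{n,n'}^{-1})^{-1}$. -/

import Mathlib

open scoped Pointwise

namespace MonogenicFIM

/-! ### Rational subsets of a monoid -/

/-- The rational subsets of a monoid `M`: those obtained from finite subsets by finitely many
unions, products and stars, where `X* = ⋃ₙ Xⁿ`. -/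
inductive IsRational {M : Type*} [Monoid M] : Set M → Prop
  | finite (X : Set M) : X.Finite → IsRational X
  | union (X Y : Set M) : IsRational X → IsRational Y → IsRational (X ∪ Y)
  | mul (X Y : Set M) : IsRational X → IsRational Y → IsRational (X * Y)
  | star (X : Set M) : IsRational X → IsRational (⋃ n : ℕ, X ^ n)

/-! ### The monogenic free inverse monoid

The alphabet `{a, a⁻¹}` is `Bool`: `true` is `a` and `false` is `a⁻¹`. -/

/-- Words over `{a, a⁻¹}`. -/
abbrev Word : Type := FreeMonoid Bool

/-- The involution on words: `(x₁ ⋯ x_k)⁻¹ = x_k⁻¹ ⋯ x₁⁻¹`. -/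
def wordInv (w : Word) : Word := FreeMonoid.ofList ((FreeMonoid.toList w).map not).reverse

theorem wordInv_mul (u v : Word) : wordInv (u * v) = wordInv v * wordInv u := by
  apply FreeMonoid.toList.injective
  simp [wordInv]

theorem wordInv_wordInv (w : Word) : wordInv (wordInv w) = w := by
  apply FreeMonoid.toList.injective
  have h : (not ∘ not) = id := by funext b; simp
  simp [wordInv, h]

/-- The defining relations of the free inverse monoid on `{a}`. -/
inductive WagnerRel : Word → Word → Prop
  | regular (w : Word) : WagnerRel (w * wordInv w * w) w
  | commute (u v : Word) :
      WagnerRel (u * wordInv u * (v * wordInv v)) (v * wordInv v * (u * wordInv u))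

/-- The Wagner congruence on `{a, a⁻¹}*`. -/
def wagnerCon : Con Word := conGen WagnerRel

/-- The free inverse monoid `F` on the one-element set `{a}`. -/
abbrev F : Type := wagnerCon.Quotient

/-- The canonical homomorphism `θ` from words onto `F`. -/
def theta : Word →* F := wagnerCon.mk'

theorem theta_surjective : Function.Surjective theta := Con.mk'_surjective

theorem wagnerCon_wordInv {u v : Word} (h : wagnerCon u v) :
    wagnerCon (wordInv u) (wordInv v) := by
  induction h with
  | of x y h =>
    cases h with
    | regular w =>
      have : wagnerCon _ _ := ConGen.Rel.of _ _ (WagnerRel.regular (wordInv y))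
      simpa [wordInv_mul, wordInv_wordInv, mul_assoc] using this
    | commute u v =>
      have : wagnerCon _ _ := ConGen.Rel.of _ _ (WagnerRel.commute v u)
      simpa [wordInv_mul, wordInv_wordInv, mul_assoc] using this
  | refl x => exact wagnerCon.refl _
  | symm _ ih => exact wagnerCon.symm ih
  | trans _ _ ih₁ ih₂ => exact wagnerCon.trans ih₁ ih₂
  | mul _ _ ih₁ ih₂ =>
    rw [wordInv_mul, wordInv_mul]
    exact wagnerCon.mul ih₂ ih₁

/-- Inversion on `F`, induced by the involution on words. For `L : Set F` the pointwise inverse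
`L⁻¹` is then `{u⁻¹ | u ∈ L}`. -/
instance : InvolutiveInv F where
  inv u := Con.liftOn u (fun w => theta (wordInv w))
    (fun _ _ h => (Con.eq _).2 (wagnerCon_wordInv h))
  inv_inv u := by
    obtain ⟨w, rfl⟩ := theta_surjective u
    exact congrArg theta (wordInv_wordInv w)

theorem theta_wordInv (w : Word) : theta (wordInv w) = (theta w)⁻¹ := rfl

/-! ### The coordinates `λ`, `ρ`, `π`

Reading a word as a walk on `ℤ` that starts at `0` (`a` is a step up, `a⁻¹` a step down), `π` is the
end point, `λ` the least and `ρ` the greatest vertex visited. -/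

def step (x : Bool) : ℤ := if x then 1 else -1

def listPi : List Bool → ℤ
  | [] => 0
  | x :: w => step x + listPi w

def listLam : List Bool → ℤ
  | [] => 0
  | x :: w => min 0 (step x + listLam w)

def listRho : List Bool → ℤ
  | [] => 0
  | x :: w => max 0 (step x + listRho w)

theorem listLam_nonpos (w : List Bool) : listLam w ≤ 0 := by
  cases w <;> simp [listLam]

theorem listRho_nonneg (w : List Bool) : 0 ≤ listRho w := by
  cases w <;> simp [listRho]

theorem listPi_append (u v : List Bool) : listPi (u ++ v) = listPi u + listPi v := by
  induction u with
  | nil => simp [listPi]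
  | cons x u ih => simp only [List.cons_append, listPi, ih]; ring

theorem listLam_append (u v : List Bool) :
    listLam (u ++ v) = min (listLam u) (listPi u + listLam v) := by
  induction u with
  | nil => have := listLam_nonpos v; simp [listPi, listLam, this]
  | cons x u ih => simp only [List.cons_append, listPi, listLam, ih]; omega

theorem listRho_append (u v : List Bool) :
    listRho (u ++ v) = max (listRho u) (listPi u + listRho v) := by
  induction u with
  | nil => have := listRho_nonneg v; simp [listPi, listRho, this]
  | cons x u ih => simp only [List.cons_append, listPi, listRho, ih]; omega

theorem list_coords_inv (w : List Bool) :
    listPi (w.map not).reverse = -listPi w ∧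
    listLam (w.map not).reverse = listLam w - listPi w ∧
    listRho (w.map not).reverse = listRho w - listPi w := by
  induction w with
  | nil => simp [listPi, listLam, listRho]
  | cons x w ih =>
    obtain ⟨h₁, h₂, h₃⟩ := ih
    have := listLam_nonpos w
    have := listRho_nonneg w
    simp only [List.map_cons, List.reverse_cons, listPi_append, listLam_append, listRho_append,
      h₁, h₂, h₃, listPi, listLam, listRho]
    cases x <;> simp [step] <;> omega

/-- The congruence of having the same `π`, `λ` and `ρ`. -/
def munnCon : Con Word where
  r u v := listPi (FreeMonoid.toList u) = listPi (FreeMonoid.toList v) ∧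
    listLam (FreeMonoid.toList u) = listLam (FreeMonoid.toList v) ∧
    listRho (FreeMonoid.toList u) = listRho (FreeMonoid.toList v)
  iseqv := ⟨fun _ => ⟨rfl, rfl, rfl⟩, fun h => ⟨h.1.symm, h.2.1.symm, h.2.2.symm⟩,
    fun h k => ⟨h.1.trans k.1, h.2.1.trans k.2.1, h.2.2.trans k.2.2⟩⟩
  mul' := by
    rintro a b c d ⟨h₁, h₂, h₃⟩ ⟨k₁, k₂, k₃⟩
    simp only [FreeMonoid.toList_mul, listPi_append, listLam_append, listRho_append,
      h₁, h₂, h₃, k₁, k₂, k₃, and_self]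

theorem list_bounds (w : List Bool) :
    listLam w ≤ listPi w ∧ listPi w ≤ listRho w := by
  induction w with
  | nil => simp [listPi, listLam, listRho]
  | cons x w ih => simp only [listPi, listLam, listRho]; omega

theorem wagnerCon_le_munnCon : wagnerCon ≤ munnCon := by
  refine Con.conGen_le.2 fun x y h => ?_
  cases h with
  | regular w =>
    obtain ⟨h₁, h₂, h₃⟩ := list_coords_inv (FreeMonoid.toList y)
    have := listLam_nonpos (FreeMonoid.toList y)
    have := listRho_nonneg (FreeMonoid.toList y)
    have := list_bounds (FreeMonoid.toList y)
    refine ⟨?_, ?_, ?_⟩ <;>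
      simp only [wordInv, FreeMonoid.toList_mul, FreeMonoid.toList_ofList, listPi_append,
        listLam_append, listRho_append, h₁, h₂, h₃] <;> omega
  | commute u v =>
    obtain ⟨h₁, h₂, h₃⟩ := list_coords_inv (FreeMonoid.toList u)
    obtain ⟨k₁, k₂, k₃⟩ := list_coords_inv (FreeMonoid.toList v)
    refine ⟨?_, ?_, ?_⟩ <;>
      simp only [wordInv, FreeMonoid.toList_mul, FreeMonoid.toList_ofList, listPi_append,
        listLam_append, listRho_append, h₁, h₂, h₃, k₁, k₂, k₃] <;> omega

/-- The homomorphism `π : F → ℤ` with `a ↦ 1`. -/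
def pi (u : F) : ℤ := Con.liftOn u (fun w => listPi (FreeMonoid.toList w))
  (fun _ _ h => (wagnerCon_le_munnCon h).1)

/-- The least vertex `uλ ≤ 0`. -/
def lam (u : F) : ℤ := Con.liftOn u (fun w => listLam (FreeMonoid.toList w))
  (fun _ _ h => (wagnerCon_le_munnCon h).2.1)

/-- The greatest vertex `uρ ≥ 0`. -/
def rho (u : F) : ℤ := Con.liftOn u (fun w => listRho (FreeMonoid.toList w))
  (fun _ _ h => (wagnerCon_le_munnCon h).2.2)

/-- The generator `a` of `F`. -/
def gen : F := theta (FreeMonoid.of true)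

/-- `a^k` for `k : ℤ`, where `a^(-k) = (a⁻¹)^k`. -/
def genPow (k : ℤ) : F := if 0 ≤ k then gen ^ k.toNat else gen⁻¹ ^ (-k).toNat

/-- `a^(-i) a^(i+k) a^(-k) a^p`; for `-i ≤ p ≤ k` this is the element of `F` with
`λ = -i`, `ρ = k` and `π = p`. -/
def normalForm (i k : ℕ) (p : ℤ) : F :=
  genPow (-i) * genPow (i + k) * genPow (-k) * genPow p

theorem pi_mul (u v : F) : pi (u * v) = pi u + pi v := by
  obtain ⟨u, rfl⟩ := theta_surjective u
  obtain ⟨v, rfl⟩ := theta_surjective v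
  exact listPi_append _ _

theorem lam_mul (u v : F) : lam (u * v) = min (lam u) (pi u + lam v) := by
  obtain ⟨u, rfl⟩ := theta_surjective u
  obtain ⟨v, rfl⟩ := theta_surjective v
  exact listLam_append _ _

theorem rho_mul (u v : F) : rho (u * v) = max (rho u) (pi u + rho v) := by
  obtain ⟨u, rfl⟩ := theta_surjective u
  obtain ⟨v, rfl⟩ := theta_surjective v
  exact listRho_append _ _

theorem coords_bounds (u : F) : lam u ≤ 0 ∧ 0 ≤ rho u ∧ lam u ≤ pi u ∧ pi u ≤ rho u := by
  obtain ⟨u, rfl⟩ := theta_surjective u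
  exact ⟨listLam_nonpos _, listRho_nonneg _, (list_bounds _).1, (list_bounds _).2⟩

theorem coords_gen_pow (m : ℕ) :
    pi (gen ^ m) = m ∧ lam (gen ^ m) = 0 ∧ rho (gen ^ m) = m := by
  have h₁ : pi gen = 1 := by decide
  have h₂ : lam gen = 0 := by decide
  have h₃ : rho gen = 1 := by decide
  induction m with
  | zero => exact ⟨rfl, rfl, rfl⟩
  | succ m ih =>
    obtain ⟨k₁, k₂, k₃⟩ := ih
    rw [pow_succ, pi_mul, lam_mul, rho_mul, k₁, k₂, k₃, h₁, h₂, h₃]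
    push_cast
    omega

theorem coords_gen_inv_pow (m : ℕ) :
    pi (gen⁻¹ ^ m) = -m ∧ lam (gen⁻¹ ^ m) = -m ∧ rho (gen⁻¹ ^ m) = 0 := by
  have h₁ : pi gen⁻¹ = -1 := by decide
  have h₂ : lam gen⁻¹ = -1 := by decide
  have h₃ : rho gen⁻¹ = 0 := by decide
  induction m with
  | zero => exact ⟨rfl, rfl, rfl⟩
  | succ m ih =>
    obtain ⟨k₁, k₂, k₃⟩ := ih
    rw [pow_succ, pi_mul, lam_mul, rho_mul, k₁, k₂, k₃, h₁, h₂, h₃]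
    push_cast
    omega

theorem coords_genPow (k : ℤ) :
    pi (genPow k) = k ∧ lam (genPow k) = min 0 k ∧ rho (genPow k) = max 0 k := by
  unfold genPow
  split_ifs with h
  · obtain ⟨k₁, k₂, k₃⟩ := coords_gen_pow k.toNat
    omega
  · obtain ⟨k₁, k₂, k₃⟩ := coords_gen_inv_pow (-k).toNat
    omega

theorem coords_normalForm (i k : ℕ) (p : ℤ) (h₁ : -(i : ℤ) ≤ p) (h₂ : p ≤ k) :
    lam (normalForm i k p) = -i ∧ rho (normalForm i k p) = k ∧ pi (normalForm i k p) = p := by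
  obtain ⟨a₁, a₂, a₃⟩ := coords_genPow (-i)
  obtain ⟨b₁, b₂, b₃⟩ := coords_genPow (i + k)
  obtain ⟨c₁, c₂, c₃⟩ := coords_genPow (-k)
  obtain ⟨d₁, d₂, d₃⟩ := coords_genPow p
  simp only [normalForm, pi_mul, lam_mul, rho_mul, a₁, a₂, a₃, b₁, b₂, b₃, c₁, c₂, c₃, d₁, d₂, d₃]
  omega

theorem F_mul_inv_rev (u v : F) : (u * v)⁻¹ = v⁻¹ * u⁻¹ := by
  obtain ⟨u, rfl⟩ := theta_surjective u
  obtain ⟨v, rfl⟩ := theta_surjective v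
  rw [← map_mul, ← theta_wordInv, wordInv_mul, map_mul, theta_wordInv, theta_wordInv]

theorem F_inv_pow (u : F) (k : ℕ) : (u ^ k)⁻¹ = u⁻¹ ^ k := by
  induction k with
  | zero => rw [pow_zero, pow_zero]; rfl
  | succ k ih => rw [pow_succ, F_mul_inv_rev, ih, pow_succ']

theorem F_regular (u : F) : u * u⁻¹ * u = u := by
  obtain ⟨u, rfl⟩ := theta_surjective u
  have h : wagnerCon _ _ := ConGen.Rel.of _ _ (WagnerRel.regular u)
  exact (Con.eq _).2 h

theorem F_commute (u v : F) : u * u⁻¹ * (v * v⁻¹) = v * v⁻¹ * (u * u⁻¹) := by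
  obtain ⟨u, rfl⟩ := theta_surjective u
  obtain ⟨v, rfl⟩ := theta_surjective v
  have h : wagnerCon _ _ := ConGen.Rel.of _ _ (WagnerRel.commute u v)
  exact (Con.eq _).2 h

theorem F_pow_regular (x : F) (k : ℕ) : x ^ k * x⁻¹ ^ k * x ^ k = x ^ k := by
  rw [← F_inv_pow, F_regular]

/-- Cancelling a step back along an edge that has already been visited. -/
theorem F_pow_cancel (x : F) {k q : ℕ} (h : q + 1 ≤ k) :
    x ^ k * x⁻¹ ^ k * (x ^ (q + 1) * x⁻¹) = x ^ k * x⁻¹ ^ k * x ^ q := by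
  have h₁ : x ^ k * x⁻¹ ^ k = x ^ k * x⁻¹ ^ k * (x ^ (q + 1) * x⁻¹ ^ (q + 1)) := by
    obtain ⟨d, rfl⟩ := Nat.exists_eq_add_of_le' h
    have e := F_pow_regular x⁻¹ (q + 1)
    rw [inv_inv] at e
    calc x ^ (d + (q + 1)) * x⁻¹ ^ (d + (q + 1))
        = x ^ (d + (q + 1)) * (x⁻¹ ^ d * x⁻¹ ^ (q + 1)) := by rw [← pow_add]
      _ = x ^ (d + (q + 1)) * (x⁻¹ ^ d * (x⁻¹ ^ (q + 1) * x ^ (q + 1) * x⁻¹ ^ (q + 1))) := by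
          rw [e]
      _ = _ := by rw [pow_add x⁻¹ d (q + 1)]; simp only [mul_assoc]
  have h₂ : x ^ (q + 1) * x⁻¹ ^ (q + 1) * (x ^ (q + 1) * x⁻¹) = x ^ (q + 1) * x⁻¹ := by
    rw [← mul_assoc, F_pow_regular]
  have h₃ : x ^ (q + 1) * x⁻¹ ^ (q + 1) * x ^ q = x ^ (q + 1) * x⁻¹ := by
    have c := F_commute x (x⁻¹ ^ q)
    rw [F_inv_pow, inv_inv] at c
    calc x ^ (q + 1) * x⁻¹ ^ (q + 1) * x ^ q
        = x ^ q * (x * x⁻¹ * (x⁻¹ ^ q * x ^ q)) := by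
          rw [pow_succ x, pow_succ' x⁻¹]; simp only [mul_assoc]
      _ = x ^ q * x⁻¹ ^ q * x ^ q * (x * x⁻¹) := by rw [c]; simp only [mul_assoc]
      _ = _ := by rw [F_pow_regular, pow_succ, mul_assoc]
  rw [h₁, mul_assoc (x ^ k * x⁻¹ ^ k), h₂, mul_assoc (x ^ k * x⁻¹ ^ k), h₃]

theorem normalForm_eq (i k : ℕ) (p : ℤ) :
    normalForm i k p = gen⁻¹ ^ i * gen ^ i * (gen ^ k * gen⁻¹ ^ k) * genPow p := by
  have e₁ : ∀ m : ℕ, genPow (-(m : ℤ)) = gen⁻¹ ^ m := by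
    intro m
    unfold genPow
    split_ifs with h
    · obtain rfl : m = 0 := by omega
      rfl
    · simp
  have e₂ : genPow ((i : ℤ) + k) = gen ^ (i + k) := by
    unfold genPow
    rw [if_pos (by omega)]
    congr 1
  rw [normalForm, e₁, e₁, e₂, pow_add]
  simp only [mul_assoc]

theorem normalForm_mul_gen (i k : ℕ) (p : ℤ) (h₁ : -(i : ℤ) ≤ p) (h₂ : p ≤ k) :
    normalForm i k p * gen = normalForm i (max k (p + 1).toNat) (p + 1) := by
  have c := F_commute (gen⁻¹ ^ i) (gen ^ k)
  rw [F_inv_pow, F_inv_pow, inv_inv] at c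
  rw [normalForm_eq, normalForm_eq]
  obtain ⟨q, rfl⟩ | ⟨q, rfl⟩ : (∃ q : ℕ, p = q) ∨ ∃ q : ℕ, p = -((q : ℤ) + 1) := by
    rcases le_or_gt 0 p with h | h
    · exact .inl ⟨p.toNat, by omega⟩
    · exact .inr ⟨(-p - 1).toNat, by omega⟩
  · have g₁ : genPow q = gen ^ q := by simp [genPow]
    have g₂ : genPow ((q : ℤ) + 1) = gen ^ (q + 1) := by
      rw [genPow, if_pos (by omega)]; congr 1
    rw [g₁, g₂, mul_assoc _ _ gen, ← pow_succ]
    rcases Nat.lt_or_ge q k with h | h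
    · rw [show max k ((q : ℤ) + 1).toNat = k by omega]
    · obtain rfl : q = k := by omega
      rw [show max q ((q : ℤ) + 1).toNat = q + 1 by omega,
        mul_assoc (gen⁻¹ ^ i * gen ^ i), mul_assoc (gen⁻¹ ^ i * gen ^ i), F_pow_regular]
      congr 1
      rw [pow_succ, ← mul_assoc, F_pow_regular]
  · have g₁ : genPow (-((q : ℤ) + 1)) = gen⁻¹ ^ (q + 1) := by
      rw [genPow, if_neg (by omega)]; congr 1
    have g₂ : genPow (-((q : ℤ) + 1) + 1) = gen⁻¹ ^ q := by
      unfold genPow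
      split_ifs with h
      · obtain rfl : q = 0 := by omega
        rfl
      · congr 1; omega
    rw [g₁, g₂, show max k (-((q : ℤ) + 1) + 1).toNat = k by omega, c]
    have := F_pow_cancel gen⁻¹ (show q + 1 ≤ i by omega)
    rw [inv_inv] at this
    simp only [mul_assoc] at this ⊢
    rw [this]

theorem normalForm_mul_gen_inv (i k : ℕ) (p : ℤ) (h₁ : -(i : ℤ) ≤ p) (h₂ : p ≤ k) :
    normalForm i k p * gen⁻¹ = normalForm (max i (1 - p).toNat) k (p - 1) := by
  have c := fun i => F_commute (gen⁻¹ ^ i) (gen ^ k)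
  simp only [F_inv_pow, inv_inv] at c
  rw [normalForm_eq, normalForm_eq]
  obtain ⟨q, rfl⟩ | ⟨q, rfl⟩ : (∃ q : ℕ, p = -(q : ℤ)) ∨ ∃ q : ℕ, p = (q : ℤ) + 1 := by
    rcases le_or_gt p 0 with h | h
    · exact .inl ⟨(-p).toNat, by omega⟩
    · exact .inr ⟨(p - 1).toNat, by omega⟩
  · have g₁ : genPow (-(q : ℤ)) = gen⁻¹ ^ q := by
      unfold genPow
      split_ifs with h
      · obtain rfl : q = 0 := by omega
        rfl
      · congr 1; omega
    have g₂ : genPow (-(q : ℤ) - 1) = gen⁻¹ ^ (q + 1) := by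
      rw [genPow, if_neg (by omega)]; congr 1; omega
    rw [g₁, g₂, mul_assoc _ _ gen⁻¹, ← pow_succ]
    rcases Nat.lt_or_ge q i with h | h
    · rw [show max i (1 - -(q : ℤ)).toNat = i by omega]
    · obtain rfl : q = i := by omega
      have r := F_pow_regular gen⁻¹
      simp only [inv_inv] at r
      rw [show max q (1 - -(q : ℤ)).toNat = q + 1 by omega, c, c,
        mul_assoc (gen ^ k * gen⁻¹ ^ k), mul_assoc (gen ^ k * gen⁻¹ ^ k), r (q + 1)]
      congr 1
      rw [pow_succ, ← mul_assoc, r]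
  · have g₁ : genPow ((q : ℤ) + 1) = gen ^ (q + 1) := by
      rw [genPow, if_pos (by omega)]; congr 1
    have g₂ : genPow ((q : ℤ) + 1 - 1) = gen ^ q := by simp [genPow]
    rw [g₁, g₂, show max i (1 - ((q : ℤ) + 1)).toNat = i by omega]
    have := F_pow_cancel gen (show q + 1 ≤ k by omega)
    simp only [mul_assoc] at this ⊢
    rw [this]

/-- Every `u ∈ F` factors as `a^(-i) a^(i+k) a^(-k) a^(uπ)` with `uλ = -i` and `uρ = k`; together
with `coords_normalForm` this is the unique factorization of this form. -/
theorem normalForm_coords (u : F) : normalForm (-lam u).toNat (rho u).toNat (pi u) = u := by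
  obtain ⟨w, rfl⟩ := theta_surjective u
  induction w using List.reverseRecOn with
  | nil => rfl
  | append_singleton w x ih =>
    set u : F := theta w with hu
    obtain ⟨b₁, b₂, b₃, b₄⟩ := coords_bounds u
    cases x with
    | true =>
      change normalForm (-lam (u * gen)).toNat (rho (u * gen)).toNat (pi (u * gen)) = u * gen
      obtain ⟨k₁, k₂, k₃⟩ := coords_gen_pow 1
      rw [pow_one] at k₁ k₂ k₃
      conv_rhs => rw [← ih]
      rw [normalForm_mul_gen _ _ _ (by omega) (by omega), lam_mul, rho_mul, pi_mul, k₁, k₂, k₃]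
      congr 1 <;> omega
    | false =>
      change normalForm (-lam (u * gen⁻¹)).toNat (rho (u * gen⁻¹)).toNat (pi (u * gen⁻¹)) =
        u * gen⁻¹
      obtain ⟨k₁, k₂, k₃⟩ := coords_gen_inv_pow 1
      rw [pow_one] at k₁ k₂ k₃
      conv_rhs => rw [← ih]
      rw [normalForm_mul_gen_inv _ _ _ (by omega) (by omega), lam_mul, rho_mul, pi_mul, k₁, k₂, k₃]
      congr 1 <;> omega

/-! ### Positive and negative parts, `η`, `W` and `ζ` -/

/-- `F⁺`, the elements with `uπ ≥ 0`. -/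
def Fplus : Set F := {u | 0 ≤ pi u}

/-- `L⁺ = L ∩ ℕπ⁻¹`. -/
def plusPart (L : Set F) : Set F := {u ∈ L | 0 ≤ pi u}

/-- `L⁻ = L ∩ (-ℕ)π⁻¹`. -/
def minusPart (L : Set F) : Set F := {u ∈ L | pi u ≤ 0}

/-- `η_{n,n'}` on `ℕ`: the identity below `n'`; a number `m ≥ n'` goes to the greatest
`i ∈ {0, …, n'-1}` with `i ≡ m (mod n)`. -/
def etaNat (n n' m : ℕ) : ℕ :=
  if m < n' then m else Nat.findGreatest (fun i => i ≡ m [MOD n]) (n' - 1)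

/-- `η_{n,n'}` on `ℤ`, the odd extension. -/
def eta (n n' : ℕ) (m : ℤ) : ℤ :=
  if 0 ≤ m then (etaNat n n' m.toNat : ℤ) else -(etaNat n n' (-m).toNat : ℤ)

/-- The set `W_{n'}`. -/
def W (n' : ℕ) : Set F := {u | -(n' : ℤ) < lam u ∧ 0 ≤ pi u ∧ pi u < n' ∧ rho u - pi u < n'}

/-- `ζ_{n,n'}`, meaningful on `F⁺`: the unique element whose `λ`, `π` and `ρ - π` are the images under
`η_{n,n'}` of those of `u`. -/
def zeta (n n' : ℕ) (u : F) : F :=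
  normalForm (-eta n n' (lam u)).toNat
    (eta n n' (pi u) + eta n n' (rho u - pi u)).toNat (eta n n' (pi u))

theorem eta_nonneg (n n' : ℕ) {m : ℤ} (h : 0 ≤ m) : 0 ≤ eta n n' m := by
  simp [eta, h]

theorem eta_nonpos (n : ℕ) {n' : ℕ} (hn' : 1 ≤ n') {m : ℤ} (h : m ≤ 0) : eta n n' m ≤ 0 := by
  unfold eta
  split_ifs with h'
  · obtain rfl : m = 0 := by omega
    simp [etaNat, show 0 < n' by omega]
  · omega

theorem coords_zeta (n : ℕ) {n' : ℕ} (hn' : 1 ≤ n') {u : F} (hu : u ∈ Fplus) :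
    lam (zeta n n' u) = eta n n' (lam u) ∧ pi (zeta n n' u) = eta n n' (pi u) ∧
    rho (zeta n n' u) - pi (zeta n n' u) = eta n n' (rho u - pi u) := by
  obtain ⟨b₁, -, -, b₄⟩ := coords_bounds u
  have e₁ := eta_nonpos n hn' b₁
  have e₂ := eta_nonneg n n' (show 0 ≤ pi u from hu)
  have e₃ := eta_nonneg n n' (show 0 ≤ rho u - pi u by omega)
  obtain ⟨h₁, h₂, h₃⟩ := coords_normalForm (-eta n n' (lam u)).toNat
    (eta n n' (pi u) + eta n n' (rho u - pi u)).toNat (eta n n' (pi u)) (by omega) (by omega)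
  unfold zeta
  omega

/-- `Xζ_{n,n'}⁻¹`, where `ζ_{n,n'}` has domain `F⁺`. -/
def zetaPreimage (n n' : ℕ) (X : Set F) : Set F := {u ∈ Fplus | zeta n n' u ∈ X}

/-! ### Finite automata as inputs of algorithms -/

/-- A finite automaton over `{a, a⁻¹}`, given by the lists of its initial vertices, of its terminal
vertices and of its edges `(p, x, q)`; the vertices are natural numbers. -/
abbrev FiniteAutomaton : Type := List ℕ × List ℕ × List (ℕ × Bool × ℕ)

namespace FiniteAutomaton

def toNFA (A : FiniteAutomaton) : NFA Bool ℕ where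
  step p x := {q | (p, x, q) ∈ A.2.2}
  start := {p | p ∈ A.1}
  accept := {p | p ∈ A.2.1}

/-- The subset `(L(A))θ` of `F`. -/
def subset (A : FiniteAutomaton) : Set F :=
  {u | ∃ w ∈ A.toNFA.accepts, theta (FreeMonoid.ofList w) = u}

end FiniteAutomaton

/-- The subset `{wθ | w in the list}` of `F`. -/
def listSubset (l : List (List Bool)) : Set F :=
  {u | ∃ w ∈ l, theta (FreeMonoid.ofList w) = u}

end MonogenicFIM

open MonogenicFIM

namespace MonogenicFIM

/-! ### Decompositions of walks -/

/-! An element of `F` is determined by its three coordinates, so a point `u` with `uπ ≥ 0` lies in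
`L` exactly when the automaton has an accepting path whose walk on `ℤ` ends at `p = uπ` and has
vertex set `[-m, p + k]`, where `m = -uλ` and `k = uρ - uπ`. Everything about such walks is recorded
by finitely many relations on pairs (vertex, flag): excursions below the top level of an interval,
walks from the start to that level, and walks from it to the end, the flag telling whether the
bottom has been visited. Adding a level on top changes these relations by a fixed map, one for each
position of the new level: up to the start, between start and end, above the end. Hence membership
depends only on `raiseRight^k (raiseMiddle^p (raiseLeft^m base))` (`accepts_iff`).

The three maps act on a finite set with at most `S` elements, so their iterates have period `S!`
from exponent `S` on (`iterate_add_factorial`). With `n = S!` and `n' = S + S!`, replacing each of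
`m`, `p`, `k` by its image under `η` does not affect membership (`saturated_graphSubset`). Reversing
all edges turns `L` into `L⁻¹` on the same vertices, so the same `n`, `n'` serve the negative part.

For computability, `S` is obtained from the code of the automaton, and the finite sets are `L ∩
W_n'` and `L⁻¹ ∩ W_n'`. These are found by bounded search, since a pumping argument on suffixes
bounds the length of the words needed (`exists_short`). That every rational subset comes from an
automaton follows by lifting to regular languages, whose closure properties are proved by counting
left quotients. -/

theorem exists_first_passage (c : ℤ) (hc : 0 ≤ c) (w : List Bool) (h : c + 1 ≤ listRho w) :
    ∃ u v, w = u ++ true :: v ∧ listPi u = c ∧ listRho u ≤ c := by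
  induction w using List.reverseRecOn with
  | nil => simp [listRho] at h; omega
  | append_singleton w x ih =>
    by_cases h' : c + 1 ≤ listRho w
    · obtain ⟨u, v, rfl, h₁, h₂⟩ := ih h'
      exact ⟨u, v ++ [x], by simp, h₁, h₂⟩
    · rw [listRho_append] at h
      have hb := (list_bounds w).2
      cases x
      · simp [listRho, step] at h; omega
      · simp only [listRho, step] at h
        exact ⟨w, [], rfl, by simp at h; omega, by omega⟩

theorem exists_last_passage (w : List Bool) (h : listPi w < listRho w) :
    ∃ u v, w = u ++ false :: v ∧ listPi u = listRho w ∧ listRho u = listRho w ∧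
      listRho v = 0 := by
  induction w with
  | nil => simp [listPi, listRho] at h
  | cons x w ih =>
    have hb := list_bounds w
    have hr := listRho_nonneg w
    simp only [listPi, listRho] at h ⊢
    by_cases h' : listPi w < listRho w ∧ 0 ≤ step x + listRho w
    · obtain ⟨u, v, rfl, h₁, h₂, h₃⟩ := ih h'.1
      refine ⟨x :: u, v, rfl, ?_, ?_, h₃⟩ <;> simp only [listPi, listRho] <;> omega
    -- Here the start is the only vertex of maximal height: the first letter is a step down and the
    -- tail never rises above its own start.
    · cases x
      · refine ⟨[], w, rfl, ?_, ?_, ?_⟩ <;> simp [listPi, listRho, step] at * <;> omega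
      · simp [step] at *; omega

/-- Passing through this cut is what guarantees that the top of the interval is really visited, so
only the bottom needs a flag. -/
theorem exists_split_at_rho (w : List Bool) :
    ∃ u v, w = u ++ v ∧ listPi u = listRho w ∧ listRho u = listRho w ∧ listRho v = 0 := by
  rcases (list_bounds w).2.lt_or_eq with h | h
  · obtain ⟨u, v, h₀, h₁, h₂, h₃⟩ := exists_last_passage w h
    exact ⟨u, false :: v, h₀, h₁, h₂, by simp [listRho, step, h₃]⟩
  · exact ⟨w, [], by simp, h, rfl, rfl⟩

/-! ### Runs in a labelled graph -/

variable {Q : Type*}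

/-- `Run E q w r`: some path from `q` to `r` in the graph with edges `E` is labelled by `w`. -/
def Run (E : Q → Bool → Q → Prop) : Q → List Bool → Q → Prop
  | q, [], r => q = r
  | q, x :: w, r => ∃ s, E q x s ∧ Run E s w r

theorem run_append {E : Q → Bool → Q → Prop} {q r : Q} {u v : List Bool} :
    Run E q (u ++ v) r ↔ ∃ s, Run E q u s ∧ Run E s v r := by
  induction u generalizing q with
  | nil => simp [Run]
  | cons x u ih =>
    simp only [List.cons_append, Run, ih]
    constructor
    · rintro ⟨a, h, s, h₁, h₂⟩
      exact ⟨s, ⟨a, h, h₁⟩, h₂⟩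
    · rintro ⟨s, ⟨a, h, h₁⟩, h₂⟩
      exact ⟨a, h, s, h₁, h₂⟩

/-- Relations on pairs of a vertex and a flag. -/
abbrev FlagRel (Q : Type*) : Type _ := Q × Bool → Q × Bool → Prop

/-- There is a walk from `s` to `t` with end point `d`, not below `-j` and not above `r`; the flag is
raised when the walk visits `-j`. -/
def WalkRel (E : Q → Bool → Q → Prop) (j d r : ℤ) : FlagRel Q := fun s t =>
  ∃ w, Run E s.1 w t.1 ∧ listPi w = d ∧ -j ≤ listLam w ∧ listRho w ≤ r ∧
    (t.2 = true ↔ s.2 = true ∨ listLam w = -j)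

/-- A single edge labelled `x`. -/
def edgeRel (E : Q → Bool → Q → Prop) (x : Bool) : FlagRel Q := fun s t => E s.1 x t.1 ∧ t.2 = s.2

open Relation in
/-- Excursions below a level, computed from the excursions below the preceding level. -/
def nextRel (E : Q → Bool → Q → Prop) (T : FlagRel Q) : FlagRel Q :=
  ReflTransGen (Comp (edgeRel E false) (Comp T (edgeRel E true)))

/-- Excursions at the lowest level. -/
def baseRel : FlagRel Q := fun s t => s.1 = t.1 ∧ t.2 = true

/-! ### Cutting and gluing bounded walks -/

/-- The floor is a fixed level; `j'` is the height above it at which the second walk starts, so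
touching it means the same for both pieces. -/
theorem walkRel_glue {E : Q → Bool → Q → Prop} {x : Bool} {j d r d' r' j' D R : ℤ}
    {s a b t : Q × Bool}
    (h₁ : WalkRel E j d r s a) (h₂ : edgeRel E x a b) (h₃ : WalkRel E j' d' r' b t)
    (hj : j' = j + d + step x) (hD : D = d + step x + d') (hR : r ≤ R) (hR' : d + step x + r' ≤ R) :
    WalkRel E j D R s t := by
  obtain ⟨u, hu, h₁, h₁', h₁'', f₁⟩ := h₁
  obtain ⟨v, hv, h₃, h₃', h₃'', f₃⟩ := h₃
  have b₁ := list_bounds u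
  have b₂ := list_bounds v
  refine ⟨u ++ x :: v, run_append.2 ⟨_, hu, _, h₂.1, hv⟩, ?_, ?_, ?_, ?_⟩
  · rw [listPi_append, listPi]; omega
  · rw [listLam_append, listLam]; omega
  · rw [listRho_append, listRho]; omega
  · rw [f₃, h₂.2, f₁, or_assoc, listLam_append, listLam]
    apply or_congr Iff.rfl
    omega

theorem WalkRel.mono_ceil {E : Q → Bool → Q → Prop} {j d r d' r' : ℤ} {s t : Q × Bool}
    (h : WalkRel E j d r s t) (hd : d = d') (hr : r ≤ r') : WalkRel E j d' r' s t := by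
  obtain ⟨w, h₁, h₂, h₃, h₄, h₅⟩ := h
  exact ⟨w, h₁, h₂.trans hd, h₃, h₄.trans hr, h₅⟩

theorem walkRel_split {E : Q → Bool → Q → Prop} {x : Bool} {u v : List Bool} {j j' : ℤ}
    {s t : Q × Bool} (h : Run E s.1 (u ++ x :: v) t.1) (hl : -j ≤ listLam (u ++ x :: v))
    (hf : t.2 = true ↔ s.2 = true ∨ listLam (u ++ x :: v) = -j)
    (hj : j' = j + listPi u + step x) :
    ∃ a b, WalkRel E j (listPi u) (listRho u) s a ∧ edgeRel E x a b ∧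
      WalkRel E j' (listPi v) (listRho v) b t := by
  obtain ⟨a, h₁, b, h₂, h₃⟩ := run_append.1 h
  have b₁ := list_bounds u
  rw [listLam_append, listLam] at hl hf
  -- The flag at the cut is forced: it is up if it was up before or if `u` touches the floor.
  refine ⟨(a, s.2 || decide (listLam u = -j)), (b, s.2 || decide (listLam u = -j)),
    ⟨u, h₁, rfl, by omega, le_rfl, by simp⟩, ⟨h₂, rfl⟩, v, h₃, rfl, by omega, le_rfl, ?_⟩
  rw [hf]
  simp only [Bool.or_eq_true, decide_eq_true_eq, or_assoc]
  apply or_congr Iff.rfl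
  omega

/-- With floor and ceiling both at the start only the empty walk fits, and it already touches the
floor. -/
theorem baseRel_eq (E : Q → Bool → Q → Prop) : baseRel = WalkRel E 0 0 0 := by
  funext s t
  apply propext
  constructor
  · rintro ⟨h₁, h₂⟩
    exact ⟨[], h₁, rfl, le_rfl, le_rfl, by simp [h₂, listLam]⟩
  · rintro ⟨w, hw, h₁, h₂, h₃, h₄⟩
    cases w with
    | nil => exact ⟨hw, by simpa [listLam] using h₄⟩
    | cons x w =>
      have := listLam_nonpos w
      have := listRho_nonneg w
      simp only [listLam, listRho] at h₂ h₃
      cases x <;> simp [step] at h₂ h₃ <;> omega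

/-- Positivity of `j` keeps the empty walk off the floor, so the flag is unchanged. -/
theorem walkRel_refl (E : Q → Bool → Q → Prop) (j r : ℤ) (hj : 0 < j) (hr : 0 ≤ r) (s : Q × Bool) :
    WalkRel E j 0 r s s :=
  ⟨[], rfl, rfl, by simp [listLam]; omega, by simpa [listRho], by simp [listLam]; omega⟩

/-- A closed walk staying weakly below its start splits at its returns to the start into loops: a
step down, an excursion one level lower, a step up. -/
theorem nextRel_walkRel (E : Q → Bool → Q → Prop) (j : ℤ) (hj : 0 ≤ j) :
    nextRel E (WalkRel E j 0 0) = WalkRel E (j + 1) 0 0 := by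
  funext s t
  apply propext
  constructor
  · intro h
    induction h with
    | refl => exact walkRel_refl E _ _ (by omega) le_rfl s
    | tail _ h ih =>
      obtain ⟨a, h₁, b, h₂, h₃⟩ := h
      have h₄ : WalkRel E (j + 1) (-1) 0 _ b :=
        walkRel_glue ih h₁ h₂ (by simp [step]) (by simp [step]) le_rfl (by simp [step])
      obtain ⟨w, hw, e₁, e₂, e₃, e₄⟩ := h₄
      refine ⟨w ++ [true], run_append.2 ⟨_, hw, _, h₃.1, rfl⟩, ?_, ?_, ?_, ?_⟩
      · simp [listPi_append, listPi, step, e₁]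
      · simp [listLam_append, listLam, step, e₁]; omega
      · simp [listRho_append, listRho, step, e₁]; omega
      · rw [h₃.2, e₄]
        have := (list_bounds w).1
        simp only [listLam_append, listLam, step]
        apply or_congr Iff.rfl
        simp
        omega
  · rintro ⟨w, hw, h₁, h₂, h₃, h₄⟩
    induction hn : w.length using Nat.strong_induction_on generalizing w s with
    | _ n ih =>
      subst hn
      cases w with
      | nil =>
        obtain rfl : s = t := by
          refine Prod.ext hw ?_
          have : t.2 = true ↔ s.2 = true := by
            rw [h₄]; simp [listLam]; omega
          exact (Bool.eq_iff_iff.2 this).symm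
        exact Relation.ReflTransGen.refl
      | cons x w =>
        have hb := list_bounds w
        cases x with
        | true =>
          have := listRho_nonneg w
          simp [listRho, step] at h₃; omega
        | false =>
          simp only [listPi, step] at h₁
          -- After the step down, `w` ends one level above its own start, so it crosses that edge a
          -- first time. The part `u` before the crossing is an excursion one level lower, and `v`
          -- is a shorter instance of the claim.
          obtain ⟨u, v, rfl, e₁, e₂⟩ := exists_first_passage 0 le_rfl w (by simp at h₁; omega)
          obtain ⟨a, ha, hw⟩ := hw
          obtain ⟨b, hu, c, hb', hv⟩ := run_append.1 hw
          have b₁ := list_bounds u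
          have b₂ := list_bounds v
          have b₃ := listLam_nonpos u
          have b₄ := listLam_nonpos v
          have b₅ := listRho_nonneg v
          simp only [listPi_append, listPi, step, listLam, listLam_append, listRho,
            listRho_append] at h₁ h₂ h₃ h₄
          simp only [if_true, Bool.false_eq_true, if_false] at h₁ h₂ h₃ h₄
          refine Relation.ReflTransGen.head
            (b := (c, s.2 || decide (listLam u = -j))) ⟨(a, s.2), ⟨ha, rfl⟩,
              (b, s.2 || decide (listLam u = -j)), ⟨u, hu, e₁, by omega, e₂, by simp⟩, hb', rfl⟩ ?_
          refine ih v.length (by simp; omega) _ v hv (by omega) (by omega) (by omega) ?_ rfl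
          rw [h₄]
          simp only [Bool.or_eq_true, decide_eq_true_eq, or_assoc]
          apply or_congr Iff.rfl
          omega

open Relation in
-- The cut is at the first crossing from level `x` to `x + 1`: before it the walk stays at or below
-- `x`, after it there is an excursion below the new top.
theorem walkRel_up (E : Q → Bool → Q → Prop) (m x : ℕ) :
    Comp (WalkRel E m x x) (Comp (edgeRel E true) (WalkRel E ((m + x : ℕ) + 1) 0 0)) =
      WalkRel E m (x + 1 : ℕ) (x + 1 : ℕ) := by
  funext s t
  apply propext
  constructor
  · rintro ⟨a, h₁, b, h₂, h₃⟩
    exact walkRel_glue h₁ h₂ h₃ (by push_cast [step]; simp) (by push_cast [step]; simp)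
      (by omega) (by push_cast [step]; simp)
  · rintro ⟨w, hw, h₁, h₂, h₃, h₄⟩
    obtain ⟨u, v, rfl, e₁, e₂⟩ := exists_first_passage x (by omega) w
      (by have := list_bounds w; omega)
    obtain ⟨a, b, k₁, k₂, k₃⟩ := walkRel_split hw h₂ h₄ rfl
    simp only [listPi_append, listPi, listRho_append, listRho, step, if_true] at h₁ h₃ k₃
    refine ⟨a, k₁.mono_ceil e₁ e₂, b, k₂, ?_⟩
    convert k₃.mono_ceil (d' := 0) (r' := 0) (by omega) (by omega) using 1
    push_cast
    omega

open Relation in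
-- The cut is at the last visit to the top: before it there is an excursion below the top, and after
-- the step down the old top is never exceeded.
theorem walkRel_down (E : Q → Bool → Q → Prop) (j y : ℕ) :
    Comp (WalkRel E (j + 1) 0 0) (Comp (edgeRel E false) (WalkRel E j (-(y : ℤ)) 0)) =
      WalkRel E (j + 1) (-((y + 1 : ℕ) : ℤ)) 0 := by
  funext s t
  apply propext
  constructor
  · rintro ⟨a, h₁, b, h₂, h₃⟩
    exact walkRel_glue h₁ h₂ h₃ (by simp [step]) (by push_cast; simp [step])
      le_rfl (by simp [step])
  · rintro ⟨w, hw, h₁, h₂, h₃, h₄⟩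
    have hr : listRho w = 0 := le_antisymm h₃ (listRho_nonneg w)
    obtain ⟨u, v, rfl, e₁, e₂, e₃⟩ := exists_last_passage w (by omega)
    obtain ⟨a, b, k₁, k₂, k₃⟩ := walkRel_split hw h₂ h₄ rfl
    simp only [listPi_append, listPi, step, Bool.false_eq_true, if_false] at h₁ k₃
    refine ⟨a, k₁.mono_ceil (by omega) (by omega), b, k₂, ?_⟩
    convert k₃.mono_ceil (d' := -(y : ℤ)) (r' := 0) (by push_cast at h₁; omega) (by omega) using 1
    omega

/-! ### The behaviour of a graph on an interval -/

/-- Excursions below the current level, walks from the start to the current level, and walks from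
the current level to the end. -/
abbrev Behaviour (Q : Type*) : Type _ := FlagRel Q × FlagRel Q × FlagRel Q

/-- The interval is a single level, serving at once as bottom, start and end. -/
def baseBehaviour (Q : Type*) : Behaviour Q := (baseRel, baseRel, baseRel)

/-- Raising the level below the start. -/
def raiseLeft (E : Q → Bool → Q → Prop) (B : Behaviour Q) : Behaviour Q :=
  (nextRel E B.1, nextRel E B.1, nextRel E B.1)

open Relation in
/-- Raising the level between the start and the end. -/
def raiseMiddle (E : Q → Bool → Q → Prop) (B : Behaviour Q) : Behaviour Q :=
  (nextRel E B.1, Comp B.2.1 (Comp (edgeRel E true) (nextRel E B.1)), nextRel E B.1)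

open Relation in
/-- Raising the level above the end. -/
def raiseRight (E : Q → Bool → Q → Prop) (B : Behaviour Q) : Behaviour Q :=
  (nextRel E B.1, Comp B.2.1 (Comp (edgeRel E true) (nextRel E B.1)),
    Comp (nextRel E B.1) (Comp (edgeRel E false) B.2.2))

/-- While the left part is built the current level is the provisional start and end, so all three
components are excursions. -/
theorem raiseLeft_iterate (E : Q → Bool → Q → Prop) (m : ℕ) :
    (raiseLeft E)^[m] (baseBehaviour Q) =
      (WalkRel E m 0 0, WalkRel E m 0 0, WalkRel E m 0 0) := by
  induction m with
  | zero => simp [baseBehaviour, ← baseRel_eq]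
  | succ m ih =>
    rw [Function.iterate_succ_apply', ih]
    simp [raiseLeft, nextRel_walkRel]

theorem raiseMiddle_iterate (E : Q → Bool → Q → Prop) (m p : ℕ) :
    (raiseMiddle E)^[p] ((raiseLeft E)^[m] (baseBehaviour Q)) =
      (WalkRel E (m + p : ℕ) 0 0, WalkRel E m p p, WalkRel E (m + p : ℕ) 0 0) := by
  induction p with
  | zero => simp [raiseLeft_iterate]
  | succ p ih =>
    rw [Function.iterate_succ_apply', ih]
    simp only [raiseMiddle, nextRel_walkRel E _ (Int.natCast_nonneg _), walkRel_up]
    push_cast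
    simp only [add_assoc]

theorem raiseRight_iterate (E : Q → Bool → Q → Prop) (m p k : ℕ) :
    (raiseRight E)^[k] ((raiseMiddle E)^[p] ((raiseLeft E)^[m] (baseBehaviour Q))) =
      (WalkRel E (m + (p + k) : ℕ) 0 0, WalkRel E m (p + k : ℕ) (p + k : ℕ),
        WalkRel E (m + (p + k) : ℕ) (-(k : ℤ)) 0) := by
  induction k with
  | zero => simp [raiseMiddle_iterate]
  | succ k ih =>
    rw [Function.iterate_succ_apply', ih]
    simp only [raiseRight, nextRel_walkRel E _ (Int.natCast_nonneg _), walkRel_up, walkRel_down]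
    push_cast
    simp only [add_assoc]

/-- Some walk that the behaviour describes leads from an initial to a terminal vertex. -/
def Behaviour.Accepts (I T : Set Q) (B : Behaviour Q) : Prop :=
  ∃ q ∈ I, ∃ r ∈ T, Relation.Comp B.2.1 B.2.2 (q, false) (r, true)

theorem accepts_iff (E : Q → Bool → Q → Prop) (I T : Set Q) (m p k : ℕ) :
    ((raiseRight E)^[k] ((raiseMiddle E)^[p]
      ((raiseLeft E)^[m] (baseBehaviour Q)))).Accepts I T ↔
    ∃ q ∈ I, ∃ r ∈ T, ∃ w, Run E q w r ∧ listLam w = -m ∧ listPi w = p ∧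
      listRho w = (p + k : ℕ) := by
  rw [raiseRight_iterate]
  refine exists_congr fun q => and_congr_right fun _ => exists_congr fun r =>
    and_congr_right fun _ => ?_
  constructor
  · rintro ⟨a, ⟨u, hu, h₁, h₂, h₃, h₄⟩, v, hv, k₁, k₂, k₃, k₄⟩
    have b₁ := list_bounds u
    have b₂ := listRho_nonneg v
    refine ⟨u ++ v, run_append.2 ⟨_, hu, hv⟩, ?_, ?_, ?_⟩
    · rw [h₄] at k₄
      simp at k₄
      rw [listLam_append]
      push_cast at *
      omega
    · rw [listPi_append]; push_cast at *; omega
    · rw [listRho_append]; push_cast at *; omega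
  · rintro ⟨w, hw, h₁, h₂, h₃⟩
    obtain ⟨u, v, rfl, e₁, e₂, e₃⟩ := exists_split_at_rho w
    obtain ⟨a, hu, hv⟩ := run_append.1 hw
    rw [listLam_append] at h₁
    rw [listPi_append] at h₂
    -- The path begins with the flag down, so at the top the flag records only whether `u` reached
    -- `-m`.
    refine ⟨(a, decide (listLam u = -m)), ⟨u, hu, ?_, ?_, ?_, ?_⟩, v, hv, ?_, ?_, ?_, ?_⟩
    any_goals simp only [decide_eq_true_eq]
    all_goals push_cast at *
    any_goals omega
    · simp
    · exact iff_of_true trivial (by omega)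

/-! ### Eventual periodicity -/

/-- Two of the iterates with exponents `0, …, S` agree; the difference of their exponents is at most
`S`, hence divides `S!`. The factorial thus serves all maps on the set at once. -/
theorem iterate_add_factorial {α : Type*} [Finite α] (f : α → α) (x : α) {S i : ℕ}
    (hS : Nat.card α ≤ S) (hi : S ≤ i) : f^[i + S.factorial] x = f^[i] x := by
  obtain ⟨a, b, hab, he⟩ : ∃ a b : Fin (S + 1), a < b ∧ f^[a] x = f^[b] x := by
    have := Fintype.ofFinite α
    obtain ⟨a, b, hne, he⟩ := Fintype.exists_ne_map_eq_of_card_lt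
      (fun a : Fin (S + 1) => f^[a] x)
      (by rw [← Nat.card_eq_fintype_card, Fintype.card_fin]; omega)
    rcases lt_or_gt_of_ne hne with h | h
    · exact ⟨a, b, h, he⟩
    · exact ⟨b, a, h, he.symm⟩
  have hab : (a : ℕ) < b := hab
  have key : ∀ t, f^[i + t * (b - a)] x = f^[i] x := by
    intro t
    induction t with
    | zero => simp
    | succ t ih =>
      have h₁ : i + (t + 1) * (b - a) = (i + t * (b - a) - a) + b := by
        rw [Nat.succ_mul]; omega
      have h₂ : i + t * (b - a) = (i + t * (b - a) - a) + a := by omega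
      rw [h₁, Function.iterate_add_apply, ← he, ← Function.iterate_add_apply, ← h₂, ih]
  obtain ⟨t, ht⟩ : (b - a : ℕ) ∣ S.factorial := Nat.dvd_factorial (by omega) (by omega)
  rw [ht, mul_comm]
  exact key t

theorem etaNat_lt {n n' : ℕ} (hn' : 1 ≤ n') (m : ℕ) : etaNat n n' m < n' := by
  unfold etaNat
  split_ifs with h
  · exact h
  · have := Nat.findGreatest_le (P := fun i => i ≡ m [MOD n]) (n' - 1)
    omega

/-- The choice `n' = S + n` makes `[S, n')` a complete residue system mod `n`, so the value of `η`
at `m ≥ n'` lies in the range where `g` is already periodic. -/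
theorem apply_etaNat {β : Type*} (g : ℕ → β) {n S : ℕ} (hn : 1 ≤ n)
    (hg : ∀ i, S ≤ i → g (i + n) = g i) (m : ℕ) : g (etaNat n (S + n) m) = g m := by
  have key : ∀ i t, S ≤ i → g (i + t * n) = g i := by
    intro i t hi
    induction t with
    | zero => simp
    | succ t ih => rw [Nat.succ_mul, ← add_assoc, hg _ (by omega), ih]
  unfold etaNat
  split_ifs with h
  · rfl
  · set P := fun i => i ≡ m [MOD n] with hP
    -- This is the representative of `m` in `[S, S + n)`; the greatest one below `S + n` is
    -- therefore at least `S`.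
    have h₀ : P (S + (m - S) % n) := by
      have : S + (m - S) % n ≡ S + (m - S) [MOD n] := (Nat.mod_modEq _ _).add_left S
      rwa [show S + (m - S) = m by omega] at this
    have hlt := Nat.mod_lt (m - S) (show 0 < n by omega)
    have h₁ : S ≤ Nat.findGreatest P (S + n - 1) :=
      le_trans (by omega) (Nat.le_findGreatest (by omega) h₀)
    have h₂ : P (Nat.findGreatest P (S + n - 1)) := Nat.findGreatest_spec (by omega) h₀
    have h₃ : Nat.findGreatest P (S + n - 1) ≤ S + n - 1 := Nat.findGreatest_le _
    obtain ⟨t, ht⟩ := (Nat.modEq_iff_dvd' (by omega)).1 h₂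
    rw [← key _ t h₁, mul_comm, ← ht]
    congr 1
    omega

/-! ### Saturated subsets -/

/-- Membership in `L` depends on the image under `ζ` only. -/
def Saturated (n n' : ℕ) (L : Set F) : Prop := ∀ u ∈ Fplus, (zeta n n' u ∈ L ↔ u ∈ L)

/-- The arguments of `P` are the coordinates on which `ζ` acts separately, so they can be replaced
one at a time. -/
theorem mem_iff_coords {L : Set F} {P : ℕ → ℕ → ℕ → Prop}
    (h : ∀ u, 0 ≤ pi u → (u ∈ L ↔ P (-lam u).toNat (pi u).toNat (rho u - pi u).toNat))
    {n S : ℕ} (hn : 1 ≤ n)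
    (h₁ : ∀ m p k, S ≤ m → (P (m + n) p k = P m p k))
    (h₂ : ∀ m p k, S ≤ p → (P m (p + n) k = P m p k))
    (h₃ : ∀ m p k, S ≤ k → (P m p (k + n) = P m p k)) : Saturated n (S + n) L := by
  intro u hu
  obtain ⟨b₁, -, -, b₄⟩ := coords_bounds u
  have hu' : 0 ≤ pi u := hu
  obtain ⟨c₁, c₂, c₃⟩ := coords_zeta n (n' := S + n) (by omega) hu
  have e₁ : (-lam (zeta n (S + n) u)).toNat = etaNat n (S + n) (-lam u).toNat := by
    rw [c₁, eta]
    split_ifs with h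
    · simp [show lam u = 0 by omega, etaNat, show 0 < S + n by omega]
    · simp
  have e₂ : (pi (zeta n (S + n) u)).toNat = etaNat n (S + n) (pi u).toNat := by
    rw [c₂, eta, if_pos hu']; simp
  have e₃ : (rho (zeta n (S + n) u) - pi (zeta n (S + n) u)).toNat =
      etaNat n (S + n) (rho u - pi u).toNat := by
    rw [c₃, eta, if_pos (by omega)]; simp
  rw [h _ (by rw [c₂]; exact eta_nonneg _ _ hu'), h _ hu', e₁, e₂, e₃,
    apply_etaNat (fun m => P m _ _) hn (fun m => h₁ m _ _),
    apply_etaNat (fun m => P _ m _) hn (fun m => h₂ _ m _),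
    apply_etaNat (fun m => P _ _ m) hn (fun m => h₃ _ _ m)]

theorem zeta_mem_W (n : ℕ) {n' : ℕ} (hn' : 1 ≤ n') {u : F} (hu : u ∈ Fplus) :
    zeta n n' u ∈ W n' := by
  obtain ⟨b₁, -, -, b₄⟩ := coords_bounds u
  have hu' : 0 ≤ pi u := hu
  obtain ⟨c₁, c₂, c₃⟩ := coords_zeta n hn' hu
  have l₁ := etaNat_lt (n := n) hn' (-lam u).toNat
  have l₂ := etaNat_lt (n := n) hn' (pi u).toNat
  have l₃ := etaNat_lt (n := n) hn' (rho u - pi u).toNat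
  -- Needed when `λ = 0`, where `eta` takes its nonnegative branch.
  have l₄ := etaNat_lt (n := n) hn' (lam u).toNat
  refine ⟨?_, ?_, ?_, ?_⟩
  · rw [c₁, eta]; split_ifs <;> omega
  · rw [c₂]; exact eta_nonneg _ _ hu'
  · rw [c₂, eta, if_pos hu']; omega
  · rw [c₃, eta, if_pos (by omega)]; omega

/-! ### Inversion, positive and negative parts -/

theorem coords_inv (u : F) :
    pi u⁻¹ = -pi u ∧ lam u⁻¹ = lam u - pi u ∧ rho u⁻¹ = rho u - pi u := by
  obtain ⟨w, rfl⟩ := theta_surjective u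
  exact list_coords_inv (FreeMonoid.toList w)

theorem minusPart_eq (L : Set F) : minusPart L = (plusPart L⁻¹)⁻¹ := by
  ext u
  simp [minusPart, plusPart, (coords_inv u).1]

theorem inv_minusPart (L : Set F) : (minusPart L)⁻¹ = plusPart L⁻¹ := by
  rw [minusPart_eq, inv_inv]

theorem Saturated.plusPart_eq_image {n n' : ℕ} {L : Set F} (h : Saturated n n' L) :
    plusPart L = zetaPreimage n n' (zeta n n' '' plusPart L) := by
  ext u
  constructor
  · rintro hu
    exact ⟨hu.2, u, hu, rfl⟩
  · rintro ⟨hu, v, hv, e⟩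
    exact ⟨(h u hu).1 (e ▸ (h v hv.2).2 hv.1), hu⟩

theorem Saturated.plusPart_eq_inter {n n' : ℕ} {L : Set F} (h : Saturated n n' L)
    (hn' : 1 ≤ n') : plusPart L = zetaPreimage n n' (L ∩ W n') := by
  ext u
  constructor
  · rintro hu
    exact ⟨hu.2, (h u hu.2).2 hu.1, zeta_mem_W n hn' hu.2⟩
  · rintro ⟨hu, hv, -⟩
    exact ⟨(h u hu).1 hv, hu⟩

theorem plusPart_union_minusPart (L : Set F) : plusPart L ∪ minusPart L = L := by
  ext u
  simp only [plusPart, minusPart, Set.mem_union, Set.mem_sep_iff, ← and_or_left]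
  exact and_iff_left (le_total _ _)

/-! ### Subsets recognized by finite graphs -/

/-- The normal form is built from the coordinates alone; this reduces equality in `F` to a statement
about walks. -/
theorem F_ext {u v : F} (h₁ : lam u = lam v) (h₂ : pi u = pi v) (h₃ : rho u = rho v) : u = v := by
  rw [← normalForm_coords u, ← normalForm_coords v, h₁, h₂, h₃]

/-- The images in `F` of the labels of paths from `I` to `T`. -/
def graphSubset {Q : Type*} (E : Q → Bool → Q → Prop) (I T : Set Q) : Set F :=
  {u | ∃ q ∈ I, ∃ r ∈ T, ∃ w, Run E q w r ∧ theta (FreeMonoid.ofList w) = u}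

theorem coords_theta (w : List Bool) : lam (theta (FreeMonoid.ofList w)) = listLam w ∧
    pi (theta (FreeMonoid.ofList w)) = listPi w ∧ rho (theta (FreeMonoid.ofList w)) = listRho w :=
  ⟨rfl, rfl, rfl⟩

theorem card_behaviour (Q : Type*) [Finite Q] :
    Nat.card (Behaviour Q) = 2 ^ (3 * (2 * Nat.card Q) ^ 2) := by
  have h : Nat.card (FlagRel Q) = 2 ^ (2 * Nat.card Q) ^ 2 := by
    unfold FlagRel
    rw [Nat.card_fun, Nat.card_fun, Nat.card_prod]
    simp [← pow_mul]
    ring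
  unfold Behaviour
  rw [Nat.card_prod, Nat.card_prod, h, ← pow_add, ← pow_add]
  congr 1
  ring

/-- The three coordinates enter only as exponents of iterates on the finite set of behaviours. The
bound involves only the number of vertices, so it also applies to the reversed graph. -/
theorem saturated_graphSubset {Q : Type*} [Finite Q] (E : Q → Bool → Q → Prop) (I T : Set Q)
    {S : ℕ} (hS : 2 ^ (3 * (2 * Nat.card Q) ^ 2) ≤ S) :
    Saturated S.factorial (S + S.factorial) (graphSubset E I T) := by
  rw [← card_behaviour] at hS
  have : Finite (FlagRel Q) := inferInstanceAs (Finite (Q × Bool → Q × Bool → Prop))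
  refine mem_iff_coords (P := fun m p k => ((raiseRight E)^[k] ((raiseMiddle E)^[p]
      ((raiseLeft E)^[m] (baseBehaviour Q)))).Accepts I T) ?_ (Nat.factorial_pos S) ?_ ?_ ?_
  · intro u hu
    rw [accepts_iff]
    obtain ⟨b₁, b₂, b₃, b₄⟩ := coords_bounds u
    refine exists_congr fun q => and_congr_right fun _ => exists_congr fun r =>
      and_congr_right fun _ => exists_congr fun w => and_congr_right fun _ => ?_
    constructor
    · rintro rfl
      simp only [coords_theta] at *
      omega
    · rintro ⟨h₁, h₂, h₃⟩
      apply F_ext <;> simp only [coords_theta] <;> omega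
  · intro m p k hm
    simp only [iterate_add_factorial _ _ hS hm]
  · intro m p k hm
    simp only [iterate_add_factorial _ _ hS hm]
  · intro m p k hm
    simp only [iterate_add_factorial _ _ hS hm]

theorem run_map_reverse {Q : Type*} {E : Q → Bool → Q → Prop} {q r : Q} {w : List Bool} :
    Run (fun p x s => E s (!x) p) r (w.map not).reverse q ↔ Run E q w r := by
  induction w generalizing q with
  | nil => simp [Run, eq_comm]
  | cons x w ih => simp [run_append, Run, ih, and_comm]

theorem inv_graphSubset {Q : Type*} (E : Q → Bool → Q → Prop) (I T : Set Q) :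
    (graphSubset E I T)⁻¹ = graphSubset (fun p x s => E s (!x) p) T I := by
  -- One inclusion suffices: reversing twice restores the graph and inverting twice restores the
  -- element.
  have key : ∀ (Q : Type _) (E : Q → Bool → Q → Prop) (I T : Set Q) (u : F),
      u ∈ graphSubset E I T → u⁻¹ ∈ graphSubset (fun p x s => E s (!x) p) T I := by
    rintro Q E I T u ⟨q, hq, r, hr, w, hw, rfl⟩
    exact ⟨r, hr, q, hq, _, run_map_reverse.2 hw, theta_wordInv (FreeMonoid.ofList w)⟩
  ext u
  constructor
  · intro hu
    have := key _ _ _ _ _ hu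
    rwa [inv_inv] at this
  · intro hu
    have := key _ _ _ _ _ hu
    simpa using this

/-! ### Closure properties of regular languages -/

/-- By Myhill–Nerode: a finite family has finitely many subfamilies, hence finitely many unions can
occur as left quotients. -/
theorem isRegular_of_leftQuotient_union {α : Type} {K : Language α} {G : Set (Set (List α))}
    (hG : G.Finite) (h : ∀ x, ∃ S ⊆ G, ∀ y, x ++ y ∈ K ↔ y ∈ ⋃₀ S) : K.IsRegular := by
  refine Language.IsRegular.of_finite_range_leftQuotient
    ((hG.powerset.image (fun S => (⋃₀ S : Set (List α)))).subset ?_)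
  rintro _ ⟨x, rfl⟩
  obtain ⟨S, hS, hx⟩ := h x
  exact ⟨S, hS, Set.ext fun y => (hx y).symm⟩

theorem isRegular_singleton {α : Type} (w : List α) : Language.IsRegular ({w} : Language α) := by
  refine isRegular_of_leftQuotient_union (G := (fun v => ({v} : Set (List α))) '' {v | v ∈ w.tails})
    (Set.Finite.image _ (List.finite_toSet _)) fun x =>
      ⟨{B | ∃ v, x ++ v = w ∧ B = {v}}, ?_, fun y => ?_⟩
  · rintro _ ⟨v, rfl, rfl⟩
    exact ⟨v, by simp, rfl⟩
  · constructor
    · intro h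
      exact ⟨{y}, ⟨y, h, rfl⟩, rfl⟩
    · rintro ⟨_, ⟨v, h, rfl⟩, rfl⟩
      exact h

theorem isRegular_of_finite {α : Type} {K : Language α} (h : Set.Finite (K : Set (List α))) :
    K.IsRegular := by
  refine Set.Finite.induction_on (motive := fun (s : Set (List α)) _ =>
    Language.IsRegular (s : Language α)) _ h ?_ ?_
  · exact isRegular_of_leftQuotient_union (G := ∅) Set.finite_empty
      fun x => ⟨∅, le_rfl, fun y => by simp; exact fun h => h⟩
  · intro w s _ _ hs
    exact (isRegular_singleton w).add hs

/-- `x⁻¹(KL)` is the union of `(x⁻¹K)L` and all `v⁻¹L` with `x = uv`, `u ∈ K`, according to whether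
the cut falls after or inside `x`. -/
theorem isRegular_mul {α : Type} {K L : Language α} (hK : K.IsRegular) (hL : L.IsRegular) :
    (K * L).IsRegular := by
  refine isRegular_of_leftQuotient_union
    (G := ((fun P : Language α => (P * L : Language α)) '' Set.range K.leftQuotient) ∪
      Set.range L.leftQuotient)
    ((hK.finite_range_leftQuotient.image _).union hL.finite_range_leftQuotient) fun x =>
      ⟨{K.leftQuotient x * L} ∪ {B | ∃ u v, x = u ++ v ∧ u ∈ K ∧ B = L.leftQuotient v},
        ?_, fun y => ?_⟩
  · rintro _ (rfl | ⟨u, v, -, -, rfl⟩)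
    · exact .inl ⟨_, ⟨x, rfl⟩, rfl⟩
    · exact .inr ⟨v, rfl⟩
  · constructor
    · intro h
      obtain ⟨u, hu, v, hv, e⟩ := Language.mem_mul.1 h
      obtain ⟨c, rfl, rfl⟩ | ⟨c, rfl, rfl⟩ := List.append_eq_append_iff.1 e
      · exact ⟨_, .inr ⟨u, c, rfl, hu, rfl⟩, hv⟩
      · exact ⟨_, .inl rfl, Language.mem_mul.2 ⟨c, hu, v, hv, rfl⟩⟩
    · rintro ⟨_, rfl | ⟨u, v, rfl, hu, rfl⟩, hy⟩
      · obtain ⟨c, hc, v, hv, rfl⟩ := Language.mem_mul.1 hy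
        exact Language.mem_mul.2 ⟨x ++ c, hc, v, hv, by simp⟩
      · exact Language.mem_mul.2 ⟨u, hu, v ++ y, hy, by simp⟩

open Computability in
-- `x⁻¹K*` is the union of all `(v⁻¹K)K*` with `x = uv`, `u ∈ K*`, together with `K*` itself when `x
-- ∈ K*`.
theorem isRegular_kstar {α : Type} {K : Language α} (hK : K.IsRegular) : (K∗).IsRegular := by
  refine isRegular_of_leftQuotient_union
    (G := ((fun P : Language α => (P * K∗ : Language α)) '' Set.range K.leftQuotient) ∪ {K∗})
    ((hK.finite_range_leftQuotient.image _).union (Set.finite_singleton _)) fun x =>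
      ⟨{B | ∃ u v, x = u ++ v ∧ u ∈ K∗ ∧ B = (K.leftQuotient v * K∗ : Language α)} ∪
        {B | x ∈ K∗ ∧ B = K∗}, ?_, fun y => ?_⟩
  · rintro _ (⟨u, v, -, -, rfl⟩ | ⟨-, rfl⟩)
    · exact .inl ⟨_, ⟨v, rfl⟩, rfl⟩
    · exact .inr rfl
  · have hmul : ∀ {u v : List α}, u ∈ K∗ → v ∈ K∗ → u ++ v ∈ K∗ := by
      intro u v hu hv
      obtain ⟨S, rfl, hS⟩ := Language.mem_kstar.1 hu
      obtain ⟨S', rfl, hS'⟩ := Language.mem_kstar.1 hv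
      exact Language.mem_kstar.2 ⟨S ++ S', by simp, fun z hz =>
        (List.mem_append.1 hz).elim (hS z) (hS' z)⟩
    have hone : ∀ {u : List α}, u ∈ K → u ∈ K∗ := fun {u} hu =>
      Language.mem_kstar.2 ⟨[u], by simp, by simpa⟩
    constructor
    · intro h
      obtain ⟨S, e, hS⟩ := Language.mem_kstar.1 h
      -- Generalized for induction on the factors: `z` collects those already used up inside the
      -- prefix.
      suffices H : ∀ (S : List (List α)) (x z : List α), (∀ y ∈ S, y ∈ K) → z ∈ K∗ →
          x ++ y = S.flatten → y ∈ ⋃₀ ({B : Set (List α) | ∃ u v, z ++ x = u ++ v ∧ u ∈ K∗ ∧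
            B = (K.leftQuotient v * K∗ : Language α)} ∪ {B | z ++ x ∈ K∗ ∧ B = K∗}) by
        exact H S x [] hS (Language.nil_mem_kstar _) e
      intro S
      induction S with
      | nil =>
        intro x z _ hz e
        obtain ⟨rfl, rfl⟩ := List.append_eq_nil_iff.1 e
        exact ⟨_, .inr ⟨by simpa, rfl⟩, Language.nil_mem_kstar _⟩
      | cons s S ih =>
        intro x z hS hz e
        rw [List.flatten_cons] at e
        have hs := hS s (by simp)
        have hS' : ∀ y ∈ S, y ∈ K := fun y hy => hS y (by simp [hy])
        obtain ⟨c, rfl, rfl⟩ | ⟨c, rfl, e'⟩ := List.append_eq_append_iff.1 e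
        · exact ⟨_, .inl ⟨z, x, rfl, hz, rfl⟩, Language.mem_mul.2
            ⟨c, hs, _, Language.mem_kstar.2 ⟨S, rfl, hS'⟩, rfl⟩⟩
        · have := ih c (z ++ s) hS' (hmul hz (hone hs)) e'.symm
          rwa [List.append_assoc] at this
    · rintro ⟨_, ⟨u, v, rfl, hu, rfl⟩ | ⟨hx, rfl⟩, hy⟩
      · obtain ⟨c, hc, d, hd, rfl⟩ := Language.mem_mul.1 hy
        have := hmul hu (hmul (hone hc) hd)
        simpa using this
      · exact hmul hx hy

/-! ### Rational subsets are recognized by automata -/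

theorem theta_ofList_append (u v : List Bool) : theta (FreeMonoid.ofList (u ++ v)) =
    theta (FreeMonoid.ofList u) * theta (FreeMonoid.ofList v) := by
  rw [FreeMonoid.ofList_append, map_mul]

open Computability in
theorem IsRational.exists_isRegular {L : Set F} (h : IsRational L) :
    ∃ K : Language Bool, K.IsRegular ∧ ∀ u, u ∈ L ↔ ∃ w ∈ K, theta (FreeMonoid.ofList w) = u := by
  induction h with
  | finite X hX =>
    refine ⟨(fun u : F => FreeMonoid.toList (Function.surjInv theta_surjective u)) '' X,
      isRegular_of_finite (hX.image _), fun u => ⟨fun hu => ⟨_, ⟨u, hu, rfl⟩, ?_⟩, ?_⟩⟩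
    · exact Function.surjInv_eq theta_surjective u
    · rintro ⟨_, ⟨v, hv, rfl⟩, rfl⟩
      have := Function.surjInv_eq theta_surjective v
      simpa [this] using hv
  | union X Y _ _ ihX ihY =>
    obtain ⟨K, hK, eK⟩ := ihX
    obtain ⟨K', hK', eK'⟩ := ihY
    refine ⟨K + K', hK.add hK', fun u => ?_⟩
    simp only [Set.mem_union, eK, eK', Language.mem_add, or_and_right, exists_or]
  | mul X Y _ _ ihX ihY =>
    obtain ⟨K, hK, eK⟩ := ihX
    obtain ⟨K', hK', eK'⟩ := ihY
    refine ⟨K * K', isRegular_mul hK hK', fun u => ?_⟩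
    simp only [Set.mem_mul, eK, eK', Language.mem_mul]
    constructor
    · rintro ⟨_, ⟨v, hv, rfl⟩, _, ⟨w, hw, rfl⟩, rfl⟩
      exact ⟨v ++ w, ⟨v, hv, w, hw, rfl⟩, theta_ofList_append v w⟩
    · rintro ⟨_, ⟨v, hv, w, hw, rfl⟩, rfl⟩
      exact ⟨_, ⟨v, hv, rfl⟩, _, ⟨w, hw, rfl⟩, (theta_ofList_append v w).symm⟩
  | star X _ ihX =>
    obtain ⟨K, hK, eK⟩ := ihX
    refine ⟨K∗, isRegular_kstar hK, fun u => ?_⟩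
    have key : ∀ (n : ℕ) u, u ∈ X ^ n ↔ ∃ w ∈ K ^ n, theta (FreeMonoid.ofList w) = u := by
      intro n
      induction n with
      | zero =>
        intro u
        simp only [pow_zero, Set.mem_one, Language.mem_one]
        constructor
        · rintro rfl
          exact ⟨[], rfl, rfl⟩
        · rintro ⟨_, rfl, rfl⟩
          rfl
      | succ n ih =>
        intro u
        simp only [pow_succ, Set.mem_mul, ih, eK, Language.mem_mul]
        constructor
        · rintro ⟨_, ⟨v, hv, rfl⟩, _, ⟨w, hw, rfl⟩, rfl⟩
          exact ⟨v ++ w, ⟨v, hv, w, hw, rfl⟩, theta_ofList_append v w⟩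
        · rintro ⟨_, ⟨v, hv, w, hw, rfl⟩, rfl⟩
          exact ⟨_, ⟨v, hv, rfl⟩, _, ⟨w, hw, rfl⟩, (theta_ofList_append v w).symm⟩
    simp only [Set.mem_iUnion, key, Language.kstar_eq_iSup_pow, Language.mem_iSup]
    constructor
    · rintro ⟨n, w, hw, rfl⟩
      exact ⟨w, ⟨n, hw⟩, rfl⟩
    · rintro ⟨w, ⟨n, hw⟩, rfl⟩
      exact ⟨n, w, hw, rfl⟩

theorem exists_list_mem_iff {α : Type*} {s : Set α} (h : s.Finite) :
    ∃ l : List α, ∀ x, x ∈ l ↔ x ∈ s :=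
  ⟨h.toFinset.toList, by simp⟩

theorem run_iff_mem_evalFrom {Q : Type*} (M : NFA Bool Q) (q r : Q) (w : List Bool) :
    Run (fun p x s => s ∈ M.step p x) q w r ↔ r ∈ M.evalFrom {q} w := by
  induction w generalizing q with
  | nil => simp [Run, eq_comm]
  | cons x w ih =>
    rw [NFA.evalFrom_cons, NFA.stepSet_singleton, NFA.mem_evalFrom_iff_exists]
    simp only [Run, ih]

theorem FiniteAutomaton.subset_eq_graphSubset (A : FiniteAutomaton) :
    A.subset = graphSubset (fun p x q => (p, x, q) ∈ A.2.2) {p | p ∈ A.1} {p | p ∈ A.2.1} := by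
  ext u
  have key : ∀ w, w ∈ A.toNFA.accepts ↔
      ∃ q ∈ A.1, ∃ r ∈ A.2.1, Run (fun p x q => (p, x, q) ∈ A.2.2) q w r := by
    intro w
    have := run_iff_mem_evalFrom A.toNFA
    rw [NFA.mem_accepts]
    simp only [NFA.mem_evalFrom_iff_exists (M := A.toNFA) (S := A.toNFA.start), ← this]
    constructor
    · rintro ⟨r, hr, q, hq, h⟩
      exact ⟨q, hq, r, hr, h⟩
    · rintro ⟨q, hq, r, hr, h⟩
      exact ⟨r, hr, q, hq, h⟩
  constructor
  · rintro ⟨w, hw, rfl⟩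
    obtain ⟨q, hq, r, hr, h⟩ := (key w).1 hw
    exact ⟨q, hq, r, hr, w, h, rfl⟩
  · rintro ⟨q, hq, r, hr, w, h, rfl⟩
    exact ⟨w, (key w).2 ⟨q, hq, r, hr, h⟩, rfl⟩

/-- `hE` constrains only edges leaving the image of `f`: a path that starts there stays there. -/
theorem run_map_of_injective {Q R : Type*} {f : Q → R} (hf : Function.Injective f)
    {E : Q → Bool → Q → Prop} {E' : R → Bool → R → Prop}
    (hE : ∀ q x r, E' (f q) x r ↔ ∃ s, E q x s ∧ f s = r) {q r : Q} {w : List Bool} :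
    Run E' (f q) w (f r) ↔ Run E q w r := by
  induction w generalizing q with
  | nil => simp [Run, hf.eq_iff]
  | cons x w ih =>
    simp only [Run, hE]
    constructor
    · rintro ⟨_, ⟨s, h, rfl⟩, h'⟩
      exact ⟨s, h, ih.1 h'⟩
    · rintro ⟨s, h, h'⟩
      exact ⟨_, ⟨s, h, rfl⟩, ih.2 h'⟩

theorem graphSubset_map_of_injective {Q R : Type*} {f : Q → R} (hf : Function.Injective f)
    {E : Q → Bool → Q → Prop} {E' : R → Bool → R → Prop}
    (hE : ∀ q x r, E' (f q) x r ↔ ∃ s, E q x s ∧ f s = r) {I T : Set Q} :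
    graphSubset E' (f '' I) (f '' T) = graphSubset E I T := by
  ext u
  constructor
  · rintro ⟨_, ⟨q, hq, rfl⟩, _, ⟨r, hr, rfl⟩, w, h, rfl⟩
    exact ⟨q, hq, r, hr, w, (run_map_of_injective hf hE).1 h, rfl⟩
  · rintro ⟨q, hq, r, hr, w, h, rfl⟩
    exact ⟨_, ⟨q, hq, rfl⟩, _, ⟨r, hr, rfl⟩, w, (run_map_of_injective hf hE).2 h, rfl⟩

theorem exists_automaton_graphSubset {Q : Type*} [Finite Q] (E : Q → Bool → Q → Prop)
    (I T : Set Q) : ∃ A : FiniteAutomaton, A.subset = graphSubset E I T := by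
  obtain ⟨n, ⟨e⟩⟩ := Finite.exists_equiv_fin Q
  let f : Q → ℕ := fun q => e q
  have hf : Function.Injective f := Fin.val_injective.comp e.injective
  obtain ⟨lI, hI⟩ := exists_list_mem_iff ((Set.toFinite I).image f)
  obtain ⟨lT, hT⟩ := exists_list_mem_iff ((Set.toFinite T).image f)
  obtain ⟨lE, hE⟩ := exists_list_mem_iff ((Set.toFinite {t : Q × Bool × Q | E t.1 t.2.1 t.2.2}).image
    (fun t : Q × Bool × Q => (f t.1, t.2.1, f t.2.2)))
  refine ⟨(lI, lT, lE), ?_⟩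
  rw [FiniteAutomaton.subset_eq_graphSubset, ← graphSubset_map_of_injective hf
    (E' := fun p x q => (p, x, q) ∈ lE)]
  · congr 1 <;> ext x <;> simp [hI, hT]
  · intro q x r
    rw [hE]
    constructor
    · rintro ⟨⟨p, y, s⟩, h, e⟩
      simp only [Prod.mk.injEq] at e
      obtain ⟨e₁, rfl, rfl⟩ := e
      obtain rfl := hf e₁
      exact ⟨s, h, rfl⟩
    · rintro ⟨s, h, rfl⟩
      exact ⟨(q, x, s), h, rfl⟩

theorem IsRational.exists_automaton {L : Set F} (h : IsRational L) :
    ∃ A : FiniteAutomaton, A.subset = L := by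
  obtain ⟨K, ⟨Q, hQ, M, rfl⟩, hL⟩ := h.exists_isRegular
  obtain ⟨A, hA⟩ := exists_automaton_graphSubset (fun p x s => s ∈ M.toNFA.step p x)
    M.toNFA.start M.toNFA.accept
  refine ⟨A, hA.trans (Set.ext fun u => ?_)⟩
  rw [hL, ← M.toNFA_correct]
  simp only [graphSubset, run_iff_mem_evalFrom, NFA.mem_accepts,
    NFA.mem_evalFrom_iff_exists (S := M.toNFA.start), Set.mem_ofPred_eq]
  constructor
  · rintro ⟨q, hq, r, hr, w, h, rfl⟩
    exact ⟨w, ⟨r, hr, q, hq, h⟩, rfl⟩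
  · rintro ⟨w, ⟨r, hr, q, hq, h⟩, rfl⟩
    exact ⟨q, hq, r, hr, w, h, rfl⟩

/-! ### Vertices are bounded by the code of the automaton -/

/-- Pairing dominates its components. Hence the code of an automaton exceeds all its vertices, a
crude bound that is trivially primitive recursive. -/
theorem encode_lt_of_mem {α : Type*} [Encodable α] {x : α} {l : List α} (h : x ∈ l) :
    Encodable.encode x < Encodable.encode l := by
  induction l with
  | nil => simp at h
  | cons y l ih =>
    rw [Encodable.encode_list_cons]
    rcases List.mem_cons.1 h with rfl | h
    · exact Nat.lt_succ_of_le (Nat.left_le_pair _ _)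
    · exact Nat.lt_succ_of_le ((ih h).le.trans (Nat.right_le_pair _ _))

namespace FiniteAutomaton

/-- A bound on the vertices of an automaton. -/
def vertexBound (A : FiniteAutomaton) : ℕ := Encodable.encode A + 1

theorem lt_vertexBound_of_initial {A : FiniteAutomaton} {p : ℕ} (h : p ∈ A.1) :
    p < A.vertexBound := by
  have h₁ := encode_lt_of_mem h
  have h₂ : Encodable.encode A.1 ≤ Encodable.encode A := Nat.left_le_pair _ _
  rw [Encodable.encode_nat] at h₁
  unfold vertexBound
  omega

theorem lt_vertexBound_of_terminal {A : FiniteAutomaton} {p : ℕ} (h : p ∈ A.2.1) :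
    p < A.vertexBound := by
  have h₁ := encode_lt_of_mem h
  have h₂ : Encodable.encode A.2 ≤ Encodable.encode A := Nat.right_le_pair _ _
  have h₃ : Encodable.encode A.2.1 ≤ Encodable.encode A.2 := Nat.left_le_pair _ _
  rw [Encodable.encode_nat] at h₁
  unfold vertexBound
  omega

theorem lt_vertexBound_of_edge {A : FiniteAutomaton} {p q : ℕ} {x : Bool}
    (h : (p, x, q) ∈ A.2.2) : q < A.vertexBound := by
  have h₁ := encode_lt_of_mem h
  have h₂ : Encodable.encode A.2 ≤ Encodable.encode A := Nat.right_le_pair _ _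
  have h₃ : Encodable.encode A.2.2 ≤ Encodable.encode A.2 := Nat.right_le_pair _ _
  have h₄ : q ≤ Encodable.encode (x, q) := Nat.right_le_pair _ _
  have h₅ : Encodable.encode (x, q) ≤ Encodable.encode (p, x, q) := Nat.right_le_pair _ _
  unfold vertexBound
  omega

theorem subset_eq_graphSubset_fin (A : FiniteAutomaton) :
    A.subset = graphSubset (Q := Fin A.vertexBound)
      (fun p x q => ((p : ℕ), x, (q : ℕ)) ∈ A.2.2) {p | (p : ℕ) ∈ A.1} {p | (p : ℕ) ∈ A.2.1} := by
  rw [subset_eq_graphSubset, ← graphSubset_map_of_injective Fin.val_injective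
    (E' := fun p x q => (p, x, q) ∈ A.2.2)]
  · congr 1 <;> ext p <;> simp only [Set.mem_image, Set.mem_ofPred_eq]
    · exact ⟨fun h => ⟨⟨p, lt_vertexBound_of_initial h⟩, h, rfl⟩, by rintro ⟨_, h, rfl⟩; exact h⟩
    · exact ⟨fun h => ⟨⟨p, lt_vertexBound_of_terminal h⟩, h, rfl⟩, by rintro ⟨_, h, rfl⟩; exact h⟩
  · intro q x r
    exact ⟨fun h => ⟨⟨r, lt_vertexBound_of_edge h⟩, h, rfl⟩, by rintro ⟨_, h, rfl⟩; exact h⟩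

/-- A bound on the number of behaviours of an automaton on an interval. -/
def behaviourBound (A : FiniteAutomaton) : ℕ := 2 ^ (3 * (2 * A.vertexBound) ^ 2)

/-- The number `n` assigned to an automaton. -/
def period (A : FiniteAutomaton) : ℕ := A.behaviourBound.factorial

/-- The number `n'` assigned to an automaton. -/
def threshold (A : FiniteAutomaton) : ℕ := A.behaviourBound + A.period

theorem saturated_subset (A : FiniteAutomaton) :
    Saturated A.period A.threshold A.subset := by
  rw [subset_eq_graphSubset_fin]
  exact saturated_graphSubset _ _ _ (by rw [Nat.card_fin]; rfl)

theorem saturated_inv_subset (A : FiniteAutomaton) :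
    Saturated A.period A.threshold A.subset⁻¹ := by
  rw [subset_eq_graphSubset_fin, inv_graphSubset]
  exact saturated_graphSubset _ _ _ (by rw [Nat.card_fin]; rfl)

/-! ### Deciding acceptance, and coordinates in `ℕ` -/

/-- One step of the backward simulation of an automaton. -/
def predecessors (A : FiniteAutomaton) (x : Bool) (S : List ℕ) : List ℕ :=
  -- Membership is written as a bounded search for an equal entry, the form in which its primitive
  -- recursiveness is derived.
  (A.2.2.filter fun t => t.2.1 = x ∧ ∃ q ∈ S, q = t.2.2).map Prod.fst

/-- The vertices from which a word leads to a terminal vertex. -/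
def coreach (A : FiniteAutomaton) (w : List Bool) : List ℕ :=
  w.foldr (fun x S => A.predecessors x S) A.2.1

/-- The word `w` is accepted. -/
def Accepts (A : FiniteAutomaton) (w : List Bool) : Prop := ∃ q ∈ A.coreach w, ∃ p ∈ A.1, p = q

theorem mem_predecessors {A : FiniteAutomaton} {x : Bool} {S : List ℕ} {p : ℕ} :
    p ∈ A.predecessors x S ↔ ∃ q ∈ S, (p, x, q) ∈ A.2.2 := by
  simp only [predecessors, List.mem_map, List.mem_filter, decide_eq_true_eq]
  constructor
  · rintro ⟨⟨p, x, q⟩, ⟨h, rfl, r, hr, e⟩, rfl⟩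
    obtain rfl : r = q := e
    exact ⟨r, hr, h⟩
  · rintro ⟨q, hq, h⟩
    exact ⟨_, ⟨h, rfl, q, hq, rfl⟩, rfl⟩

theorem mem_coreach {A : FiniteAutomaton} {w : List Bool} {p : ℕ} :
    p ∈ A.coreach w ↔ ∃ r ∈ A.2.1, Run (fun p x q => (p, x, q) ∈ A.2.2) p w r := by
  induction w generalizing p with
  | nil => simp [coreach, Run]
  | cons x w ih =>
    rw [coreach, List.foldr_cons, mem_predecessors]
    change (∃ q ∈ A.coreach w, _) ↔ _
    simp only [ih, Run]
    constructor
    · rintro ⟨q, ⟨r, hr, h⟩, h'⟩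
      exact ⟨r, hr, q, h', h⟩
    · rintro ⟨r, hr, q, h', h⟩
      exact ⟨q, ⟨r, hr, h⟩, h'⟩

theorem mem_subset {A : FiniteAutomaton} {u : F} :
    u ∈ A.subset ↔ ∃ w, A.Accepts w ∧ theta (FreeMonoid.ofList w) = u := by
  rw [subset_eq_graphSubset]
  simp only [Accepts, mem_coreach]
  constructor
  · rintro ⟨q, hq, r, hr, w, h, rfl⟩
    exact ⟨w, ⟨q, ⟨r, hr, h⟩, q, hq, rfl⟩, rfl⟩
  · rintro ⟨w, ⟨q, ⟨r, hr, h⟩, _, hq, rfl⟩, rfl⟩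
    exact ⟨_, hq, r, hr, w, h, rfl⟩

/-- Backward simulation sees a suffix only through its set of vertices, so suffixes with equal sets
are interchangeable. -/
theorem coreach_append {A : FiniteAutomaton} {u v v' : List Bool}
    (h : ∀ p, p ∈ A.coreach v ↔ p ∈ A.coreach v') (p : ℕ) :
    p ∈ A.coreach (u ++ v) ↔ p ∈ A.coreach (u ++ v') := by
  induction u generalizing p with
  | nil => exact h p
  | cons x u ih =>
    change p ∈ A.predecessors x (A.coreach (u ++ v)) ↔ p ∈ A.predecessors x (A.coreach (u ++ v'))
    simp only [mem_predecessors, ih]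

theorem lt_vertexBound_of_mem_coreach {A : FiniteAutomaton} {w : List Bool} {p : ℕ}
    (h : p ∈ A.coreach w) : p < A.vertexBound := by
  cases w with
  | nil => exact lt_vertexBound_of_terminal h
  | cons x w =>
    obtain ⟨q, -, h⟩ := mem_predecessors.1 h
    have h₁ := encode_lt_of_mem h
    have h₂ : Encodable.encode A.2 ≤ Encodable.encode A := Nat.right_le_pair _ _
    have h₃ : Encodable.encode A.2.2 ≤ Encodable.encode A.2 := Nat.right_le_pair _ _
    have h₄ : p ≤ Encodable.encode (p, x, q) := Nat.left_le_pair _ _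
    unfold vertexBound
    omega

end FiniteAutomaton

/-- The numbers `-λ`, `π - λ` and `ρ - λ` of a word. -/
def natCoords (w : List Bool) : ℕ × ℕ × ℕ :=
  -- Subtraction is truncated: `1 - c.1` is `1` exactly when the tail never goes below its start,
  -- and then the prepended step up creates a new lowest vertex.
  w.foldr (fun x c => if x = true then (c.1 - 1, c.2.1 + (1 - c.1), c.2.2 + (1 - c.1))
    else (c.1 + 1, c.2.1, max c.2.2 (c.1 + 1))) (0, 0, 0)

theorem natCoords_spec (w : List Bool) : ((natCoords w).1 : ℤ) = -listLam w ∧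
    ((natCoords w).2.1 : ℤ) = listPi w - listLam w ∧
    ((natCoords w).2.2 : ℤ) = listRho w - listLam w := by
  induction w with
  | nil => simp [natCoords, listPi, listLam, listRho]
  | cons x w ih =>
    have e : natCoords (x :: w) = if x = true then ((natCoords w).1 - 1,
        (natCoords w).2.1 + (1 - (natCoords w).1), (natCoords w).2.2 + (1 - (natCoords w).1))
      else ((natCoords w).1 + 1, (natCoords w).2.1,
        max (natCoords w).2.2 ((natCoords w).1 + 1)) := rfl
    have := listLam_nonpos w
    have := listRho_nonneg w
    rw [e]
    simp only [listPi, listLam, listRho]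
    cases x <;> simp [step] <;> omega

theorem natCoords_append_congr {u v v' : List Bool} (h : natCoords v = natCoords v') :
    natCoords (u ++ v) = natCoords (u ++ v') := by
  simp only [natCoords, List.foldr_append] at h ⊢
  rw [h]

theorem natCoords_append_le (u v : List Bool) :
    (natCoords v).2.2 ≤ (natCoords (u ++ v)).2.2 := by
  have h₁ := natCoords_spec v
  have h₂ := natCoords_spec (u ++ v)
  rw [listPi_append, listLam_append, listRho_append] at h₂
  have := list_bounds v
  omega

theorem natCoords_eq_iff {v w : List Bool} : natCoords v = natCoords w ↔
    theta (FreeMonoid.ofList v) = theta (FreeMonoid.ofList w) := by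
  have h₁ := natCoords_spec v
  have h₂ := natCoords_spec w
  constructor
  · intro h
    rw [h] at h₁
    apply F_ext <;> simp only [coords_theta] <;> omega
  · intro h
    obtain ⟨a₁, a₂, a₃⟩ := coords_theta v
    obtain ⟨b₁, b₂, b₃⟩ := coords_theta w
    rw [h] at a₁ a₂ a₃
    refine Prod.ext (by omega) (Prod.ext (by omega) (by omega))

/-! ### Short words suffice -/

/-- Pumping: acceptance and coordinates are both computed from the right, so if two suffixes have
the same vertex set and coordinates, the factor between them can be deleted. There are at most `2 ^
vertexBound` sets and `K ^ 3` coordinate triples, since a suffix is no wider than the whole walk. -/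
theorem FiniteAutomaton.exists_short (A : FiniteAutomaton) (K : ℕ) (w : List Bool)
    (hw : A.Accepts w) (hK : (natCoords w).2.2 < K) :
    ∃ v, v.length ≤ 2 ^ A.vertexBound * K ^ 3 ∧ A.Accepts v ∧ natCoords v = natCoords w := by
  induction hn : w.length using Nat.strong_induction_on generalizing w with
  | _ n ih =>
    subst hn
    by_cases hl : w.length ≤ 2 ^ A.vertexBound * K ^ 3
    · exact ⟨w, hl, hw, rfl⟩
    have hsuf : ∀ i, (natCoords (w.drop i)).2.2 < K := fun i => by
      have := natCoords_append_le (w.take i) (w.drop i)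
      rw [List.take_append_drop] at this
      omega
    have hbd : ∀ i, (natCoords (w.drop i)).1 < K ∧ (natCoords (w.drop i)).2.1 < K := fun i => by
      have h₁ := natCoords_spec (w.drop i)
      have h₂ := list_bounds (w.drop i)
      have h₃ := listRho_nonneg (w.drop i)
      have h₄ := hsuf i
      omega
    let c : Fin (w.length + 1) → Set (Fin A.vertexBound) × Fin K × Fin K × Fin K := fun i =>
      ({p | (p : ℕ) ∈ A.coreach (w.drop i)}, ⟨_, (hbd i).1⟩, ⟨_, (hbd i).2⟩, ⟨_, hsuf i⟩)
    obtain ⟨i, j, hne, he⟩ := Fintype.exists_ne_map_eq_of_card_lt c (by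
      simp only [Fintype.card_prod, Fintype.card_set, Fintype.card_fin]
      have : K * (K * K) = K ^ 3 := by ring
      rw [this]
      omega)
    wlog hij : i < j generalizing i j
    · exact this j i hne.symm he.symm (lt_of_le_of_ne (not_lt.1 hij) hne.symm)
    have hij' : (i : ℕ) < j := hij
    have hj := j.2
    simp only [c, Prod.mk.injEq, Fin.mk.injEq] at he
    obtain ⟨e₀, e₁, e₂, e₃⟩ := he
    have hset : ∀ p, p ∈ A.coreach (w.drop i) ↔ p ∈ A.coreach (w.drop j) := fun p => by
      by_cases hp : p < A.vertexBound
      · exact Set.ext_iff.1 e₀ ⟨p, hp⟩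
      · exact iff_of_false (fun h => hp (lt_vertexBound_of_mem_coreach h))
          (fun h => hp (lt_vertexBound_of_mem_coreach h))
    have hc : natCoords (w.drop i) = natCoords (w.drop j) :=
      Prod.ext e₁ (Prod.ext e₂ e₃)
    have hset' := coreach_append (u := w.take i) hset
    have hc' := natCoords_append_congr (u := w.take i) hc
    rw [List.take_append_drop] at hset' hc'
    obtain ⟨v, h₁, h₂, h₃⟩ := ih (w.take i ++ w.drop j).length
      (by simp; omega) _ (by simpa only [Accepts, hset'] using hw) (hc' ▸ hK) rfl
    exact ⟨v, h₁, h₂, h₃.trans hc'.symm⟩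

/-- The words of length at most `k`. -/
def wordsUpTo (k : ℕ) : List (List Bool) :=
  Nat.rec [[]] (fun _ l => [] :: (l.map (List.cons true) ++ l.map (List.cons false))) k

theorem mem_wordsUpTo {k : ℕ} {w : List Bool} (h : w.length ≤ k) : w ∈ wordsUpTo k := by
  induction k generalizing w with
  | zero =>
    obtain rfl := List.length_eq_zero_iff.1 (Nat.le_zero.1 h)
    simp [wordsUpTo]
  | succ k ih =>
    change w ∈ [] :: ((wordsUpTo k).map (List.cons true) ++ (wordsUpTo k).map (List.cons false))
    cases w with
    | nil => simp
    | cons x w =>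
      have := ih (w := w) (by simpa using h)
      cases x <;> simp [this]

/-! ### The lists of representatives -/

/-- The word represents an element of `W_n'`. -/
def InWindow (n' : ℕ) (w : List Bool) : Prop :=
  (natCoords w).1 < n' ∧ (natCoords w).1 ≤ (natCoords w).2.1 ∧
    (natCoords w).2.1 < n' + (natCoords w).1 ∧ (natCoords w).2.2 < n' + (natCoords w).2.1

/-- The inverse of the word represents an element of `W_n'`. -/
def InvInWindow (n' : ℕ) (w : List Bool) : Prop :=
  (natCoords w).2.1 < n' ∧ (natCoords w).2.1 ≤ (natCoords w).1 ∧
    (natCoords w).1 < n' + (natCoords w).2.1 ∧ (natCoords w).2.2 < n' + (natCoords w).1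

theorem inWindow_iff {n' : ℕ} {w : List Bool} :
    InWindow n' w ↔ theta (FreeMonoid.ofList w) ∈ W n' := by
  obtain ⟨h₁, h₂, h₃⟩ := natCoords_spec w
  simp only [InWindow, W, Set.mem_ofPred_eq, coords_theta]
  omega

theorem invInWindow_iff {n' : ℕ} {w : List Bool} :
    InvInWindow n' w ↔ (theta (FreeMonoid.ofList w))⁻¹ ∈ W n' := by
  obtain ⟨h₁, h₂, h₃⟩ := natCoords_spec w
  obtain ⟨k₁, k₂, k₃⟩ := coords_inv (theta (FreeMonoid.ofList w))
  simp only [InvInWindow, W, Set.mem_ofPred_eq, k₁, k₂, k₃, coords_theta]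
  omega

namespace FiniteAutomaton

/-- A bound on the length of shortest representatives of elements of `W_n'`. -/
def lengthBound (A : FiniteAutomaton) : ℕ := 2 ^ A.vertexBound * (3 * A.threshold) ^ 3

open Classical in
/-- Words representing the elements of `L ∩ W_n'`. -/
noncomputable def representatives (A : FiniteAutomaton) : List (List Bool) :=
  (wordsUpTo A.lengthBound).filter fun w => A.Accepts w ∧ InWindow A.threshold w

open Classical in
/-- Words representing the elements of `L⁻¹ ∩ W_n'`. -/
noncomputable def invRepresentatives (A : FiniteAutomaton) : List (List Bool) :=
  ((wordsUpTo A.lengthBound).filter fun w => A.Accepts w ∧ InvInWindow A.threshold w).map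
    fun w => (w.map not).reverse

theorem listSubset_representatives (A : FiniteAutomaton) :
    listSubset A.representatives = A.subset ∩ W A.threshold := by
  ext u
  simp only [listSubset, representatives, Set.mem_ofPred_eq, List.mem_filter, decide_eq_true_eq,
    Set.mem_inter_iff, mem_subset]
  constructor
  · rintro ⟨w, ⟨-, hw, hc⟩, rfl⟩
    exact ⟨⟨w, hw, rfl⟩, inWindow_iff.1 hc⟩
  · rintro ⟨⟨w, hw, rfl⟩, hc⟩
    have hc' := inWindow_iff.2 hc
    -- The width `ρ - λ` is the sum of `-λ`, `π` and `ρ - π`, each less than `n'`; hence the factor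
    -- `3`.
    obtain ⟨v, h₁, h₂, h₃⟩ := A.exists_short (3 * A.threshold) w hw
      (by obtain ⟨_, _, _, _⟩ := hc'; omega)
    have e := natCoords_eq_iff.1 h₃
    exact ⟨v, ⟨mem_wordsUpTo h₁, h₂, inWindow_iff.2 (e ▸ hc)⟩, e⟩

theorem listSubset_invRepresentatives (A : FiniteAutomaton) :
    listSubset A.invRepresentatives = A.subset⁻¹ ∩ W A.threshold := by
  ext u
  simp only [listSubset, invRepresentatives, Set.mem_ofPred_eq, List.mem_filter, List.mem_map,
    decide_eq_true_eq, Set.mem_inter_iff, Set.mem_inv, mem_subset]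
  constructor
  · rintro ⟨_, ⟨w, ⟨-, hw, hc⟩, rfl⟩, rfl⟩
    exact ⟨⟨w, hw, (inv_inv (theta (FreeMonoid.ofList w))).symm⟩, invInWindow_iff.1 hc⟩
  · rintro ⟨⟨w, hw, e₀⟩, hc⟩
    have hc' := invInWindow_iff.2 (show (theta (FreeMonoid.ofList w))⁻¹ ∈ _ by rwa [e₀, inv_inv])
    obtain ⟨v, h₁, h₂, h₃⟩ := A.exists_short (3 * A.threshold) w hw
      (by obtain ⟨_, _, _, _⟩ := hc'; omega)
    have e := (natCoords_eq_iff.1 h₃).trans e₀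
    refine ⟨_, ⟨v, ⟨mem_wordsUpTo h₁, h₂, invInWindow_iff.2 (by rwa [e, inv_inv])⟩, rfl⟩, ?_⟩
    exact (congrArg (·⁻¹) e).trans (inv_inv u)

/-! ### Computability -/

theorem primrec_vertexBound : Primrec vertexBound := Primrec.succ.comp Primrec.encode

end FiniteAutomaton

theorem primrec_pow : Primrec₂ ((· ^ ·) : ℕ → ℕ → ℕ) := by
  have : Primrec₂ fun a n : ℕ => Nat.rec (motive := fun _ => ℕ) 1 (fun _ y => y * a) n :=
    Primrec.nat_rec (Primrec.const 1)
      (Primrec.nat_mul.comp (Primrec.snd.comp Primrec.snd) Primrec.fst).to₂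
  refine this.of_eq fun a n => ?_
  induction n with
  | zero => rfl
  | succ n ih => rw [pow_succ, ← ih]

theorem primrec_factorial : Primrec Nat.factorial := by
  have : Primrec fun n : ℕ => Nat.rec (motive := fun _ => ℕ) 1 (fun k y => (k + 1) * y) n :=
    Primrec.nat_rec₁ 1 (Primrec.nat_mul.comp (Primrec.succ.comp Primrec.fst) Primrec.snd)
  refine this.of_eq fun n => ?_
  induction n with
  | zero => rfl
  | succ n ih => rw [Nat.factorial_succ, ← ih]

theorem primrec_wordsUpTo : Primrec wordsUpTo := by
  refine Primrec.nat_rec₁ _ ?_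
  refine Primrec.list_cons.comp (Primrec.const []) (Primrec.list_append.comp ?_ ?_)
  · exact Primrec.list_map Primrec.snd (Primrec.list_cons.comp (Primrec.const true) Primrec.snd)
  · exact Primrec.list_map Primrec.snd (Primrec.list_cons.comp (Primrec.const false) Primrec.snd)

theorem primrec_natCoords : Primrec natCoords := by
  refine Primrec.list_foldr (h := fun (_ : List Bool) (a : Bool × ℕ × ℕ × ℕ) =>
    if a.1 = true then (a.2.1 - 1, a.2.2.1 + (1 - a.2.1), a.2.2.2 + (1 - a.2.1))
      else (a.2.1 + 1, a.2.2.1, max a.2.2.2 (a.2.1 + 1))) Primrec.id (Primrec.const _) ?_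
  have c : Primrec fun a : List Bool × Bool × ℕ × ℕ × ℕ => a.2.2 :=
    Primrec.snd.comp Primrec.snd
  have c₁ := Primrec.fst.comp c
  have c₂ := Primrec.fst.comp (Primrec.snd.comp c)
  have c₃ := Primrec.snd.comp (Primrec.snd.comp c)
  have one : Primrec fun _ : List Bool × Bool × ℕ × ℕ × ℕ => 1 := Primrec.const 1
  have d := Primrec.nat_sub.comp one c₁
  have s := Primrec.nat_add.comp c₁ one
  exact Primrec.ite (Primrec.eq.comp (Primrec.fst.comp Primrec.snd) (Primrec.const true))
    (Primrec.pair (Primrec.nat_sub.comp c₁ one)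
      (Primrec.pair (Primrec.nat_add.comp c₂ d) (Primrec.nat_add.comp c₃ d)))
    (Primrec.pair s (Primrec.pair c₂ (Primrec.nat_max.comp c₃ s)))

theorem primrecRel_inWindow : PrimrecRel InWindow := by
  have c : Primrec fun a : ℕ × List Bool => natCoords a.2 := primrec_natCoords.comp Primrec.snd
  have c₁ := Primrec.fst.comp c
  have c₂ := Primrec.fst.comp (Primrec.snd.comp c)
  have c₃ := Primrec.snd.comp (Primrec.snd.comp c)
  exact (Primrec.nat_lt.comp c₁ Primrec.fst).and ((Primrec.nat_le.comp c₁ c₂).and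
    ((Primrec.nat_lt.comp c₂ (Primrec.nat_add.comp Primrec.fst c₁)).and
      (Primrec.nat_lt.comp c₃ (Primrec.nat_add.comp Primrec.fst c₂))))

theorem primrecRel_invInWindow : PrimrecRel InvInWindow := by
  have c : Primrec fun a : ℕ × List Bool => natCoords a.2 := primrec_natCoords.comp Primrec.snd
  have c₁ := Primrec.fst.comp c
  have c₂ := Primrec.fst.comp (Primrec.snd.comp c)
  have c₃ := Primrec.snd.comp (Primrec.snd.comp c)
  exact (Primrec.nat_lt.comp c₂ Primrec.fst).and ((Primrec.nat_le.comp c₂ c₁).and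
    ((Primrec.nat_lt.comp c₁ (Primrec.nat_add.comp Primrec.fst c₂)).and
      (Primrec.nat_lt.comp c₃ (Primrec.nat_add.comp Primrec.fst c₁))))

namespace FiniteAutomaton

theorem primrec_behaviourBound : Primrec behaviourBound :=
  primrec_pow.comp (Primrec.const 2) (Primrec.nat_mul.comp (Primrec.const 3)
    (primrec_pow.comp (Primrec.nat_mul.comp (Primrec.const 2) primrec_vertexBound)
      (Primrec.const 2)))

theorem primrec_period : Primrec period := primrec_factorial.comp primrec_behaviourBound

theorem primrec_threshold : Primrec threshold :=
  Primrec.nat_add.comp primrec_behaviourBound primrec_period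

theorem primrec_lengthBound : Primrec lengthBound :=
  Primrec.nat_mul.comp (primrec_pow.comp (Primrec.const 2) primrec_vertexBound)
    (primrec_pow.comp (Primrec.nat_mul.comp (Primrec.const 3) primrec_threshold)
      (Primrec.const 3))

theorem primrec_predecessors :
    Primrec fun a : FiniteAutomaton × Bool × List ℕ => a.1.predecessors a.2.1 a.2.2 := by
  have h : PrimrecRel fun (t : ℕ × Bool × ℕ) (b : Bool × List ℕ) =>
      t.2.1 = b.1 ∧ ∃ q ∈ b.2, q = t.2.2 := by
    refine PrimrecPred.and
      (Primrec.eq.comp (Primrec.fst.comp (Primrec.snd.comp Primrec.fst))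
        (Primrec.fst.comp Primrec.snd)) ?_
    exact (PrimrecRel.exists_mem_list Primrec.eq).comp (Primrec.snd.comp Primrec.snd)
      (Primrec.snd.comp (Primrec.snd.comp Primrec.fst))
  exact Primrec.list_map (h.listFilter.comp
    (Primrec.snd.comp (Primrec.snd.comp Primrec.fst)) Primrec.snd)
    (Primrec.fst.comp Primrec.snd)

theorem primrec_coreach : Primrec₂ coreach := by
  refine Primrec.list_foldr
    (h := fun (a : FiniteAutomaton × List Bool) (b : Bool × List ℕ) => a.1.predecessors b.1 b.2)
    Primrec.snd (Primrec.fst.comp (Primrec.snd.comp Primrec.fst)) ?_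
  exact primrec_predecessors.comp (Primrec.pair (Primrec.fst.comp Primrec.fst) Primrec.snd)

theorem primrecRel_accepts : PrimrecRel Accepts := by
  have h : PrimrecRel fun (q : ℕ) (l : List ℕ) => ∃ p ∈ l, p = q :=
    (PrimrecRel.exists_mem_list Primrec.eq).comp Primrec.snd Primrec.fst
  exact h.exists_mem_list.comp primrec_coreach (Primrec.fst.comp Primrec.fst)

/-- Being primitive recursive depends on the function alone, so the classical decision in its
definition is harmless: the filtering predicate is itself primitive recursive. -/
theorem primrec_representatives : Primrec representatives := by
  classical
  have h : PrimrecRel fun (w : List Bool) (A : FiniteAutomaton) =>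
      A.Accepts w ∧ InWindow A.threshold w :=
    PrimrecPred.and (primrecRel_accepts.comp Primrec.snd Primrec.fst)
      (primrecRel_inWindow.comp (primrec_threshold.comp Primrec.snd) Primrec.fst)
  refine (h.listFilter.comp (primrec_wordsUpTo.comp primrec_lengthBound) Primrec.id).of_eq
    fun A => ?_
  simp [representatives]

theorem primrec_invRepresentatives : Primrec invRepresentatives := by
  classical
  have h : PrimrecRel fun (w : List Bool) (A : FiniteAutomaton) =>
      A.Accepts w ∧ InvInWindow A.threshold w :=
    PrimrecPred.and (primrecRel_accepts.comp Primrec.snd Primrec.fst)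
      (primrecRel_invInWindow.comp (primrec_threshold.comp Primrec.snd) Primrec.fst)
  refine (Primrec.list_map (h.listFilter.comp (primrec_wordsUpTo.comp primrec_lengthBound)
    Primrec.id) (g := fun _ w => (w.map not).reverse)
    (Primrec.list_reverse.comp (Primrec.list_map Primrec.snd
      (Primrec.not.comp Primrec.snd).to₂)).to₂).of_eq fun A => ?_
  simp [invRepresentatives]

end FiniteAutomaton

end MonogenicFIM

/-! ### The main theorem -/

open MonogenicFIM
theorem mainTheorem9 :
    ∃ (n n' : FiniteAutomaton → ℕ) (V V' : FiniteAutomaton → List (List Bool)),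
      Computable n ∧ Computable n' ∧ Computable V ∧ Computable V' ∧
      ∀ L : Set F, IsRational L →
        (∃ A : FiniteAutomaton, A.subset = L) ∧
        ∀ A : FiniteAutomaton, A.subset = L →
          1 ≤ n A ∧ n A ≤ n' A ∧
          (plusPart L = zetaPreimage (n A) (n' A) (zeta (n A) (n' A) '' plusPart L) ∧
            plusPart L = zetaPreimage (n A) (n' A) (L ∩ W (n' A))) ∧
          (minusPart L = (zetaPreimage (n A) (n' A) (zeta (n A) (n' A) '' (minusPart L)⁻¹))⁻¹ ∧
            minusPart L = (zetaPreimage (n A) (n' A) (L⁻¹ ∩ W (n' A)))⁻¹) ∧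
          (listSubset (V A) ⊆ W (n' A) ∧ listSubset (V' A) ⊆ W (n' A) ∧
            L = zetaPreimage (n A) (n' A) (listSubset (V A)) ∪
              (zetaPreimage (n A) (n' A) (listSubset (V' A)))⁻¹) := by
  refine ⟨FiniteAutomaton.period, FiniteAutomaton.threshold, FiniteAutomaton.representatives,
    FiniteAutomaton.invRepresentatives, FiniteAutomaton.primrec_period.to_comp,
    FiniteAutomaton.primrec_threshold.to_comp, FiniteAutomaton.primrec_representatives.to_comp,
    FiniteAutomaton.primrec_invRepresentatives.to_comp,
    fun L hL => ⟨hL.exists_automaton, ?_⟩⟩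
  rintro A rfl
  have h₁ : 1 ≤ A.period := Nat.factorial_pos _
  have h₂ : A.period ≤ A.threshold := Nat.le_add_left _ _
  have hp := A.saturated_subset.plusPart_eq_inter (h₁.trans h₂)
  have hm := A.saturated_inv_subset.plusPart_eq_inter (h₁.trans h₂)
  refine ⟨h₁, h₂, ⟨A.saturated_subset.plusPart_eq_image, hp⟩, ⟨?_, ?_⟩, ?_, ?_, ?_⟩
  · rw [inv_minusPart, ← A.saturated_inv_subset.plusPart_eq_image, minusPart_eq]
  · rw [← hm, minusPart_eq]
  · rw [A.listSubset_representatives]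
    exact Set.inter_subset_right
  · rw [A.listSubset_invRepresentatives]
    exact Set.inter_subset_right
  -- The two preimages are `L⁺` and `(L⁻¹)⁺`; inverting the latter gives `L⁻`.
  · rw [A.listSubset_representatives, A.listSubset_invRepresentatives, ← hp, ← hm,
      ← minusPart_eq, plusPart_union_minusPart]
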